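/- Let $G$ be a (discrete) group. Let $C_*$ be a bounded chain complex, indexed by $\mathbb Z$, of finitely generated free left $\mathbb C G$-modules, each $C_n$ equipped with a finite $\mathbb C G$-basis $B_n$ (only its class up to reordering and multiplying basis elements by signs matters). Let $V$ be a finite-dimensional complex $G$-representation with a $\mathbb C$-basis $B_V$, and suppose that $V$ is unitary, i.e., that $G$ acts isometrically for the Hilbert space structure on $V$ for which $B_V$ is orthonormal. Let $\eta(C_*)$ be the $\mathbb C G$-chain complex $C_*\otimes_{\mathbb C}V$ with differentials $c_n\otimes\mathrm{id}_V$, with the diagonal $G$-action $g(x\otimes v)=gx\otimes gv$ and with the $\mathbb C G$-bases $\{b\otimes v\mid b\in B_n, v\in B_V\}$. For such a based complex $D_*$ let $\Lambda(D_*)=L^2(G)\otimes_{\mathbb C G}D_*$ be the associated complex of finitely generated Hilbert $\mathcal N(G)$-modules, where $L^2(G)\otimes_{\mathbb C G}D_n$ carries the Hilbert space structure for which $\bigoplus_{b}L^2(G)\to L^2(G)\otimes_{\mathbb C G}D_n$, $(x_b)_b\mapsto\sum_b x_b\otimes b$, is an isometry ($b$ running through the given basis of $D_n$). For a bounded $G$-equivariant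 operator $f$ between finitely generated Hilbert $\mathcal N(G)$-modules, the spectral density function is $$F(f)(\lambda)=\sup\{\dim_{\mathcal N(G)}(L)\mid L \text{ a closed } G\text{-invariant subspace of the domain with } \|f(x)\|\le\lambda\|x\| \text{ for all } x\in L\},\quad \lambda\ge 0.$$ The operator $f$ is of determinant class if $\int_{0+}^\infty\ln(\lambda)\,dF(f)(\lambda)>-\infty$, and then $\ln\det_{\mathcal N(G)}(f)$ is this integral. For a finite Hilbert $\mathcal N(G)$-chain complex $E_*$ with differentials $e_n$, let $F_n(E_*)$ be the spectral density function of $e_n|\colon \mathrm{im}(e_{n+1})^\perp\to E_{n-1}$ and let $b_n^{(2)}(E_*;\mathcal N(G))=\dim_{\mathcal N(G)}\bigl(\ker(e_n)/\overline{\mathrm{im}(e_{n+1})}\bigr)$. The Novikov-Shubin invariant is $\alpha_n(E_*;\mathcal N(G))=\liminf_{\lambda\to0+}\frac{\ln(F_n(\lambda)-F_n(0))}{\ln\lambda}\in[0,\infty]$, with $F_n=F_n(E_*)$, if $F_n(\lambda)>F_n(0)$ for all $\lambda>0$, and the symbol $\infty^+$ otherwise. Call $E_*$ of determinant class if all its differentials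 are, and then put $\rho^{(2)}(E_*;\mathcal N(G))=-\sum_n(-1)^n\ln\det_{\mathcal N(G)}(e_n)$. Then: 1. For all $n\in\mathbb Z$ and $\lambda\in[0,\infty)$, $$F_n(\Lambda\circ\eta(C_*))(\lambda)=\dim_{\mathbb C}(V)\cdot F_n(\Lambda(C_*))(\lambda).$$ 2. For all $n\in\mathbb Z$, $$b_n^{(2)}(\Lambda\circ\eta(C_*);\mathcal N(G))=\dim_{\mathbb C}(V)\cdot b_n^{(2)}(\Lambda(C_*);\mathcal N(G)).$$ 3. If $V\neq0$, then for all $n\in\mathbb Z$, $$\alpha_n(\Lambda\circ\eta(C_*);\mathcal N(G))=\alpha_n(\Lambda(C_*);\mathcal N(G)).$$ 4. If $V\neq0$, then $\Lambda\circ\eta(C_*)$ is of determinant class if and only if $\Lambda(C_*)$ is of determinant class. For every $V$ (including $V=0$), if $\Lambda(C_*)$ is of determinant class, then so is $\Lambda\circ\eta(C_*)$, and $$\rho^{(2)}(\Lambda\circ\eta(C_*);\mathcal N(G))=\dim_{\mathbb C}(V)\cdot\rho^{(2)}(\Lambda(C_*);\mathcal N(G)).$$ -/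

import Mathlib

open CategoryTheory Module Filter Topology
open scoped TensorProduct InnerProductSpace ModuleCat

noncomputable section

namespace L2Twist

universe u u' v w w₁ w₂

/-! ### Twisting `ℂ[G]`-modules with a finite-dimensional representation -/

section Twisting

variable {G : Type w} [Group G] {V : Type v} [AddCommGroup V] [Module ℂ V]
variable {κ : Type w₂}

/-- The `G`-representation `ρ` on the `ℂ`-vector space `V` with basis `c` is unitary: each `ρ g` is
isometric for the Hermitian inner product on `V` for which `c` is an orthonormal basis. -/
def IsUnitaryRep [Fintype κ] (ρ : Representation ℂ G V) (c : Basis κ ℂ V) : Prop :=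
  ∀ (g : G) (x y : V),
    ∑ k, (starRingEnd ℂ) (c.repr (ρ g x) k) * c.repr (ρ g y) k =
      ∑ k, (starRingEnd ℂ) (c.repr x k) * c.repr y k

variable (M : Type u) [AddCommGroup M] [Module ℂ M] [Module (MonoidAlgebra ℂ G) M]
  [IsScalarTower ℂ (MonoidAlgebra ℂ G) M]

/-- The diagonal representation `g (x ⊗ v) = g x ⊗ g v` of `G` on `M ⊗ V`. -/
def diagRep (ρ : Representation ℂ G V) : Representation ℂ G (M ⊗[ℂ] V) :=
  (Representation.ofModule' M).tprod ρ

/-- `(M ⊗ V)_d`: the vector space `M ⊗ V`, a `ℂ[G]`-module through the diagonal action. -/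
def DiagTensor (_ρ : Representation ℂ G V) : Type (max u v) := M ⊗[ℂ] V

instance (ρ : Representation ℂ G V) : AddCommGroup (DiagTensor M ρ) :=
  inferInstanceAs (AddCommGroup (M ⊗[ℂ] V))

instance (ρ : Representation ℂ G V) : Module ℂ (DiagTensor M ρ) :=
  inferInstanceAs (Module ℂ (M ⊗[ℂ] V))

instance (ρ : Representation ℂ G V) : Module (MonoidAlgebra ℂ G) (DiagTensor M ρ) :=
  Module.compHom (M ⊗[ℂ] V) (diagRep M ρ).asAlgebraHom.toRingHom

/-- The identity map from `(M ⊗ V)_d` to its underlying vector space `M ⊗ V`. -/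
def DiagTensor.equiv (ρ : Representation ℂ G V) : DiagTensor M ρ ≃ₗ[ℂ] M ⊗[ℂ] V :=
  LinearEquiv.refl ℂ (M ⊗[ℂ] V)

variable {M}

/-- The element `x ⊗ v` of `(M ⊗ V)_d`. -/
def DiagTensor.tmul (ρ : Representation ℂ G V) (x : M) (v : V) : DiagTensor M ρ :=
  (DiagTensor.equiv M ρ).symm (x ⊗ₜ[ℂ] v)

theorem DiagTensor.smul_def (ρ : Representation ℂ G V) (a : MonoidAlgebra ℂ G)
    (z : DiagTensor M ρ) :
    a • z = (DiagTensor.equiv M ρ).symm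
      ((diagRep M ρ).asAlgebraHom a (DiagTensor.equiv M ρ z)) := rfl

instance (ρ : Representation ℂ G V) : IsScalarTower ℂ (MonoidAlgebra ℂ G) (DiagTensor M ρ) where
  smul_assoc t a z := by
    rw [DiagTensor.smul_def, DiagTensor.smul_def, map_smul, LinearMap.smul_apply, map_smul]

theorem DiagTensor.single_smul_tmul (ρ : Representation ℂ G V) (g : G) (t : ℂ) (x : M) (v : V) :
    (MonoidAlgebra.single g t : MonoidAlgebra ℂ G) • DiagTensor.tmul ρ x v =
      t • DiagTensor.tmul ρ ((MonoidAlgebra.single g 1 : MonoidAlgebra ℂ G) • x) (ρ g v) := by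
  rw [DiagTensor.smul_def, Representation.asAlgebraHom_single]
  rfl

/-- A family whose `G`-translates form a `ℂ`-basis is a `ℂ[G]`-basis. -/
def basisOfTranslates {N : Type u'} [AddCommGroup N] [Module ℂ N] [Module (MonoidAlgebra ℂ G) N]
    [IsScalarTower ℂ (MonoidAlgebra ℂ G) N] {τ : Type w₁} (x : τ → N) (e : Basis (G × τ) ℂ N)
    (he : ∀ g i, e (g, i) = (MonoidAlgebra.single g 1 : MonoidAlgebra ℂ G) • x i) :
    Basis τ (MonoidAlgebra ℂ G) N :=
  Basis.ofRepr (LinearEquiv.symm (LinearEquiv.ofBijective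
    (Finsupp.linearCombination (MonoidAlgebra ℂ G) x) (by
      have h : ((Finsupp.linearCombination (MonoidAlgebra ℂ G) x).restrictScalars ℂ) =
          ((((MonoidAlgebra.basis G ℂ).smulTower
            (Finsupp.basisSingleOne (R := MonoidAlgebra ℂ G) (ι := τ))).equiv e
              (Equiv.refl _)).toLinearMap) := by
        refine ((MonoidAlgebra.basis G ℂ).smulTower
            (Finsupp.basisSingleOne (R := MonoidAlgebra ℂ G) (ι := τ))).ext ?_
        rintro ⟨g, i⟩
        rw [LinearEquiv.coe_coe, Basis.equiv_apply, Basis.smulTower_apply]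
        simp [he]
      have h' : ⇑(Finsupp.linearCombination (MonoidAlgebra ℂ G) x) =
          ⇑(((MonoidAlgebra.basis G ℂ).smulTower
            (Finsupp.basisSingleOne (R := MonoidAlgebra ℂ G) (ι := τ))).equiv e
              (Equiv.refl _)) := congrArg DFunLike.coe h
      rw [h']
      exact LinearEquiv.bijective _)))

theorem basisOfTranslates_apply {N : Type u'} [AddCommGroup N] [Module ℂ N]
    [Module (MonoidAlgebra ℂ G) N] [IsScalarTower ℂ (MonoidAlgebra ℂ G) N] {τ : Type w₁}
    (x : τ → N) (e : Basis (G × τ) ℂ N)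
    (he : ∀ g i, e (g, i) = (MonoidAlgebra.single g 1 : MonoidAlgebra ℂ G) • x i) (i : τ) :
    basisOfTranslates x e he i = x i := by
  simp [basisOfTranslates]

variable {ι : Type w₁}

/-- The `ℂ`-linear automorphism `g bᵢ ⊗ v ↦ g bᵢ ⊗ f g v` of `M ⊗ V`. -/
def shear (b : Basis ι (MonoidAlgebra ℂ G) M) (c : Basis κ ℂ V) (f : G → V →ₗ[ℂ] V) :
    M ⊗[ℂ] V →ₗ[ℂ] M ⊗[ℂ] V :=
  ((((MonoidAlgebra.basis G ℂ).smulTower b).tensorProduct c).constr ℂ)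
    (fun p => ((MonoidAlgebra.basis G ℂ).smulTower b p.1) ⊗ₜ[ℂ] f p.1.1 (c p.2))

theorem shear_apply (b : Basis ι (MonoidAlgebra ℂ G) M) (c : Basis κ ℂ V) (f : G → V →ₗ[ℂ] V)
    (g : G) (i : ι) (v : V) :
    shear b c f (((MonoidAlgebra.basis G ℂ).smulTower b (g, i)) ⊗ₜ[ℂ] v) =
      ((MonoidAlgebra.basis G ℂ).smulTower b (g, i)) ⊗ₜ[ℂ] f g v := by
  have h : (shear b c f) ∘ₗ
      (TensorProduct.mk ℂ M V ((MonoidAlgebra.basis G ℂ).smulTower b (g, i))) =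
      (TensorProduct.mk ℂ M V ((MonoidAlgebra.basis G ℂ).smulTower b (g, i))) ∘ₗ f g := by
    refine c.ext fun k => ?_
    simp only [LinearMap.comp_apply, TensorProduct.mk_apply]
    rw [← Basis.tensorProduct_apply, shear, Basis.constr_basis]
  exact LinearMap.congr_fun h v

theorem shear_shear (b : Basis ι (MonoidAlgebra ℂ G) M) (c : Basis κ ℂ V) (f f' : G → V →ₗ[ℂ] V)
    (h : ∀ g v, f g (f' g v) = v) : shear b c f ∘ₗ shear b c f' = LinearMap.id := by
  refine (((MonoidAlgebra.basis G ℂ).smulTower b).tensorProduct c).ext ?_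
  rintro ⟨⟨g, i⟩, k⟩
  rw [Basis.tensorProduct_apply, LinearMap.comp_apply, shear_apply, shear_apply, h]
  rfl

/-- The automorphism `g bᵢ ⊗ v ↦ g bᵢ ⊗ g v` of the vector space `M ⊗ V`. -/
def shearEquiv (ρ : Representation ℂ G V) (b : Basis ι (MonoidAlgebra ℂ G) M)
    (c : Basis κ ℂ V) : (M ⊗[ℂ] V) ≃ₗ[ℂ] (M ⊗[ℂ] V) :=
  LinearEquiv.ofLinearMap (shear b c fun g => ρ g) (shear b c fun g => ρ g⁻¹)
    (shear_shear b c _ _ fun g v => Representation.self_inv_apply ρ g v)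
    (shear_shear b c _ _ fun g v => Representation.inv_self_apply ρ g v)

/-- The `ℂ[G]`-basis `bᵢ ⊗ cₖ` of `(M ⊗ V)_d`, for a `ℂ[G]`-basis `b` of `M` and a `ℂ`-basis `c`
of `V`. -/
def twistBasis (ρ : Representation ℂ G V) (b : Basis ι (MonoidAlgebra ℂ G) M) (c : Basis κ ℂ V) :
    Basis (ι × κ) (MonoidAlgebra ℂ G) (DiagTensor M ρ) :=
  basisOfTranslates (fun p => DiagTensor.tmul ρ (b p.1) (c p.2))
    (((((MonoidAlgebra.basis G ℂ).smulTower b).tensorProduct c).map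
      (shearEquiv ρ b c ≪≫ₗ (DiagTensor.equiv M ρ).symm)).reindex (Equiv.prodAssoc G ι κ))
    (by
      rintro g ⟨i, k⟩
      rw [Basis.reindex_apply, Basis.map_apply, Equiv.prodAssoc_symm_apply,
        Basis.tensorProduct_apply, DiagTensor.single_smul_tmul, one_smul,
        LinearEquiv.trans_apply, DiagTensor.tmul]
      refine congrArg (DiagTensor.equiv M ρ).symm ((shear_apply b c _ g i (c k)).trans ?_)
      rw [Basis.smulTower_apply, MonoidAlgebra.basis_apply])

theorem twistBasis_apply (ρ : Representation ℂ G V) (b : Basis ι (MonoidAlgebra ℂ G) M)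
    (c : Basis κ ℂ V) (i : ι) (k : κ) :
    twistBasis ρ b c (i, k) = DiagTensor.tmul ρ (b i) (c k) := by
  rw [twistBasis, basisOfTranslates_apply]

/-- `f ⊗ id_V : (M ⊗ V)_d → (N ⊗ V)_d`, as a `ℂ[G]`-linear map. -/
def twistMap (ρ : Representation ℂ G V) {N : Type u} [AddCommGroup N] [Module ℂ N]
    [Module (MonoidAlgebra ℂ G) N] [IsScalarTower ℂ (MonoidAlgebra ℂ G) N]
    (f : M →ₗ[MonoidAlgebra ℂ G] N) :
    DiagTensor M ρ →ₗ[MonoidAlgebra ℂ G] DiagTensor N ρ :=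
  MonoidAlgebra.equivariantOfLinearOfComm
    ((DiagTensor.equiv N ρ).symm.toLinearMap ∘ₗ
      TensorProduct.map (f.restrictScalars ℂ) LinearMap.id ∘ₗ (DiagTensor.equiv M ρ).toLinearMap)
    (by
      intro g z
      obtain ⟨z, rfl⟩ := (DiagTensor.equiv M ρ).symm.surjective z
      simp only [DiagTensor.smul_def, LinearMap.comp_apply, LinearEquiv.coe_coe,
        LinearEquiv.apply_symm_apply, Representation.asAlgebraHom_single, one_smul]
      congr 1
      induction z using TensorProduct.induction_on with
      | zero => simp
      | add x y hx hy => simp only [map_add, hx, hy]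
      | tmul x v =>
        simp [diagRep, Representation.ofModule'])

theorem twistMap_tmul (ρ : Representation ℂ G V) {N : Type u} [AddCommGroup N] [Module ℂ N]
    [Module (MonoidAlgebra ℂ G) N] [IsScalarTower ℂ (MonoidAlgebra ℂ G) N]
    (f : M →ₗ[MonoidAlgebra ℂ G] N) (x : M) (v : V) :
    twistMap ρ f (DiagTensor.tmul ρ x v) = DiagTensor.tmul ρ (f x) v := by
  simp [twistMap, DiagTensor.tmul]

variable (G) in
/-- The functor `M ↦ (M ⊗ V)_d`, `f ↦ f ⊗ id_V` on `ℂ[G]`-modules. -/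
def twistFunctor (ρ : Representation ℂ G V) :
    ModuleCat.{u} (MonoidAlgebra ℂ G) ⥤ ModuleCat.{max u v} (MonoidAlgebra ℂ G) where
  obj M := ModuleCat.of (MonoidAlgebra ℂ G) (DiagTensor M ρ)
  map f := ModuleCat.ofHom (twistMap ρ f.hom)
  map_id M := by
    ext z
    exact LinearMap.congr_fun (TensorProduct.map_id (R := ℂ) (M := M) (N := V)) z
  map_comp {M N P} f g := by
    ext z
    exact LinearMap.congr_fun (TensorProduct.map_comp (g.hom.restrictScalars ℂ)
      (LinearMap.id : V →ₗ[ℂ] V) (f.hom.restrictScalars ℂ) (LinearMap.id : V →ₗ[ℂ] V)) z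

instance (ρ : Representation ℂ G V) : (twistFunctor.{u} G ρ).Additive where
  map_add {M N} f g := by
    ext z
    exact LinearMap.congr_fun (TensorProduct.map_add_left (f.hom.restrictScalars ℂ)
      (g.hom.restrictScalars ℂ) (LinearMap.id : V →ₗ[ℂ] V)) z

end Twisting

/-- A bounded chain complex `C_*`, indexed by `ℤ`, of finitely generated free `ℂ[G]`-modules, each
with a chosen finite `ℂ[G]`-basis. -/
structure BasedComplex (G : Type w) [Group G] where
  cx : ChainComplex (ModuleCat.{u} (MonoidAlgebra ℂ G)) ℤ
  ι : ℤ → Type w₁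
  fintypeι : ∀ n, Fintype (ι n)
  basis : ∀ n, Basis (ι n) (MonoidAlgebra ℂ G) (cx.X n)
  bounded : ∃ N : ℤ, ∀ n, N < |n| → Subsingleton (cx.X n)

attribute [instance] BasedComplex.fintypeι

/-- `η(C_*)`: the complex `(C_* ⊗ V)_d` with the bases `b ⊗ v`. -/
def BasedComplex.twist {G : Type w} [Group G] (C : BasedComplex.{u, w, w₁} G) {V : Type v}
    [AddCommGroup V] [Module ℂ V] (ρ : Representation ℂ G V) {κ : Type w₂} [Fintype κ]
    (c : Basis κ ℂ V) : BasedComplex.{max u v, w, max w₁ w₂} G where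
  cx := ((twistFunctor G ρ).mapHomologicalComplex _).obj C.cx
  ι n := C.ι n × κ
  fintypeι n := inferInstance
  basis n := twistBasis ρ (C.basis n) c
  bounded := by
    obtain ⟨N, hN⟩ := C.bounded
    refine ⟨N, fun n hn => ?_⟩
    have := hN n hn
    exact (DiagTensor.equiv (C.cx.X n) ρ).toEquiv.subsingleton

/-! ### `L²(G)` and free Hilbert modules -/

section Hilbert

variable (G : Type w) [Group G]

/-- The Hilbert space `L²(G)` of square-summable functions on the discrete group `G`. -/
abbrev L2 : Type w := lp (fun _ : G => ℂ) 2

variable {G}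

/-- Reindexing of `L²(G)` along a permutation of `G`. -/
def L2.reindex (σ : G ≃ G) : L2 G →ₗᵢ[ℂ] L2 G where
  toFun x := ⟨fun g => x (σ g), by
    change Memℓp (fun g => x (σ g)) 2
    have h := lp.memℓp x
    rw [memℓp_gen_iff (by norm_num)] at h ⊢
    exact (σ.summable_iff (f := fun g => ‖x g‖ ^ ENNReal.toReal 2)).2 h⟩
  map_add' _ _ := rfl
  map_smul' _ _ := rfl
  norm_map' x := by
    rw [lp.norm_eq_tsum_rpow (by norm_num), lp.norm_eq_tsum_rpow (by norm_num)]
    exact congrArg (fun t : ℝ => t ^ (1 / ENNReal.toReal 2))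
      (σ.tsum_eq fun g => ‖x g‖ ^ ENNReal.toReal 2)

@[simp]
theorem L2.reindex_apply (σ : G ≃ G) (x : L2 G) (g : G) : L2.reindex σ x g = x (σ g) := rfl

/-- Left translation `(h x)(g) = x(h⁻¹ g)` on `L²(G)`, the `G`-action. -/
def L2.left (h : G) : L2 G →L[ℂ] L2 G :=
  (L2.reindex (Equiv.mulLeft h⁻¹)).toContinuousLinearMap

/-- Right multiplication `(x h)(g) = x(g h⁻¹)` on `L²(G)`. -/
def L2.right (h : G) : L2 G →L[ℂ] L2 G :=
  (L2.reindex (Equiv.mulRight h⁻¹)).toContinuousLinearMap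

@[simp]
theorem L2.left_apply (h : G) (x : L2 G) (g : G) : L2.left h x g = x (h⁻¹ * g) := rfl

@[simp]
theorem L2.right_apply (h : G) (x : L2 G) (g : G) : L2.right h x g = x (g * h⁻¹) := rfl

variable (G) in
/-- The right action of `ℂ[G]` on `L²(G)` by bounded operators, as an algebra homomorphism into the
opposite algebra. -/
def L2.rightHom : MonoidAlgebra ℂ G →ₐ[ℂ] (L2 G →L[ℂ] L2 G)ᵐᵒᵖ :=
  MonoidAlgebra.lift ℂ (L2 G →L[ℂ] L2 G)ᵐᵒᵖ G
    { toFun := fun h => MulOpposite.op (L2.right h)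
      map_one' := by
        apply MulOpposite.unop_injective
        ext x g
        simp
      map_mul' := fun h k => by
        apply MulOpposite.unop_injective
        ext x g
        simp [mul_assoc] }

/-- Right multiplication `x ↦ x a` on `L²(G)` by `a ∈ ℂ[G]`. -/
def L2.rightMul (a : MonoidAlgebra ℂ G) : L2 G →L[ℂ] L2 G := (L2.rightHom G a).unop

theorem L2.rightMul_mul (a b : MonoidAlgebra ℂ G) :
    L2.rightMul (a * b) = L2.rightMul b ∘L L2.rightMul a := by
  simp [L2.rightMul, ContinuousLinearMap.mul_def]

theorem L2.rightMul_sum {τ : Type*} (s : Finset τ) (a : τ → MonoidAlgebra ℂ G) :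
    L2.rightMul (∑ i ∈ s, a i) = ∑ i ∈ s, L2.rightMul (a i) := by
  simp [L2.rightMul]

theorem L2.rightMul_single (h : G) (t : ℂ) :
    L2.rightMul (MonoidAlgebra.single h t) = t • L2.right h := by
  simp [L2.rightMul, L2.rightHom]

theorem L2.rightMul_left (a : MonoidAlgebra ℂ G) (h : G) (x : L2 G) :
    L2.rightMul a (L2.left h x) = L2.left h (L2.rightMul a x) := by
  induction a using MonoidAlgebra.induction_linear with
  | zero => simp [L2.rightMul]
  | add a b ha hb => simpa [L2.rightMul] using congrArg₂ (· + ·) ha hb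
  | single k t =>
    rw [L2.rightMul_single]
    ext g
    simp [mul_assoc]

variable (G) in
open Classical in
/-- The unit of `G`, as an element of `L²(G)`. -/
def L2.one : L2 G := lp.single 2 1 1

variable (G) in
open Classical in
theorem L2.norm_unit : ‖L2.one G‖ = 1 := by
  rw [L2.one, lp.norm_single (by norm_num)]
  simp

open Classical in
/-- The embedding `ℂ[G] ⊆ L²(G)`, `a ↦ 1 a`, sends `g` to its characteristic function. -/
theorem L2.rightMul_single_one (g : G) :
    L2.rightMul (MonoidAlgebra.single g 1) (L2.one G) = lp.single 2 g 1 := by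
  rw [L2.rightMul_single, one_smul]
  ext k
  simp [L2.one, lp.single_apply, Pi.single_apply, mul_inv_eq_one]

variable (G) in
/-- The Hilbert direct sum of copies of `L²(G)` indexed by `τ`. -/
abbrev L2Sum (τ : Type w₁) : Type (max w w₁) := PiLp 2 (fun _ : τ => L2 G)

/-- The `G`-action on `⨁ L²(G)`: left translation in each summand. -/
def L2Sum.left {τ : Type w₁} (h : G) (x : L2Sum G τ) : L2Sum G τ :=
  WithLp.toLp 2 fun i => L2.left h (x i)

/-- The operator `⨁_τ L²(G) → ⨁_σ L²(G)` given by right multiplication with a matrix over `ℂ[G]`. -/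
def L2Sum.matrixOp {τ : Type w₁} {σ : Type w₂} [Fintype τ] [Fintype σ]
    (A : τ → σ → MonoidAlgebra ℂ G) : L2Sum G τ →L[ℂ] L2Sum G σ :=
  (PiLp.continuousLinearEquiv 2 ℂ (fun _ : σ => L2 G)).symm.toContinuousLinearMap ∘L
    ContinuousLinearMap.pi fun j => ∑ i, L2.rightMul (A i j) ∘L PiLp.proj 2 (fun _ : τ => L2 G) i

@[simp]
theorem L2Sum.matrixOp_apply {τ : Type w₁} {σ : Type w₂} [Fintype τ] [Fintype σ]
    (A : τ → σ → MonoidAlgebra ℂ G) (x : L2Sum G τ) (j : σ) :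
    L2Sum.matrixOp A x j = ∑ i, L2.rightMul (A i j) (x i) := by
  simp [L2Sum.matrixOp]

theorem L2Sum.matrixOp_left {τ : Type w₁} {σ : Type w₂} [Fintype τ] [Fintype σ]
    (A : τ → σ → MonoidAlgebra ℂ G) (h : G) (x : L2Sum G τ) :
    L2Sum.matrixOp A (L2Sum.left h x) = L2Sum.left h (L2Sum.matrixOp A x) := by
  ext j : 1
  simp [L2Sum.left, L2.rightMul_left]

section Lambda

variable {τ : Type w₁} {σ : Type w₂} [Fintype τ] [Fintype σ]
variable {M : Type u} [AddCommGroup M] [Module (MonoidAlgebra ℂ G) M]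
variable {N : Type u'} [AddCommGroup N] [Module (MonoidAlgebra ℂ G) N]

/-- `Λ(f) = id ⊗ f : L²(G) ⊗_{ℂ[G]} M → L²(G) ⊗_{ℂ[G]} N`, where `L²(G) ⊗_{ℂ[G]} M` is identified
with `⨁_b L²(G)` by the isometry `(x_b) ↦ ∑ x_b ⊗ b`; if `f b = ∑ A_{bc} c`, then
`x ⊗ b ↦ x ⊗ f b = ∑ x A_{bc} ⊗ c`. -/
def lambdaOp (b : Basis τ (MonoidAlgebra ℂ G) M) (c : Basis σ (MonoidAlgebra ℂ G) N)
    (f : M →ₗ[MonoidAlgebra ℂ G] N) : L2Sum G τ →L[ℂ] L2Sum G σ :=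
  L2Sum.matrixOp fun i j => c.repr (f (b i)) j

theorem lambdaOp_comp {υ : Type*} [Fintype υ] {P : Type*} [AddCommGroup P]
    [Module (MonoidAlgebra ℂ G) P] (b : Basis τ (MonoidAlgebra ℂ G) M)
    (c : Basis σ (MonoidAlgebra ℂ G) N) (e : Basis υ (MonoidAlgebra ℂ G) P)
    (f : M →ₗ[MonoidAlgebra ℂ G] N) (g : N →ₗ[MonoidAlgebra ℂ G] P) :
    lambdaOp b e (g ∘ₗ f) = lambdaOp c e g ∘L lambdaOp b c f := by
  ext x k : 2
  have h : ∀ i, e.repr (g (f (b i))) k =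
      ∑ j, c.repr (f (b i)) j * e.repr (g (c j)) k := by
    intro i
    calc e.repr (g (f (b i))) k = e.repr (g (∑ j, c.repr (f (b i)) j • c j)) k := by
          rw [c.sum_repr]
      _ = _ := by
          rw [map_sum, map_sum, Finsupp.finsetSum_apply]
          simp only [map_smul, Finsupp.smul_apply, smul_eq_mul]
  simp only [lambdaOp, L2Sum.matrixOp_apply, ContinuousLinearMap.comp_apply, LinearMap.comp_apply,
    h, L2.rightMul_sum, L2.rightMul_mul, map_sum, sum_apply]
  exact Finset.sum_comm

theorem lambdaOp_zero (b : Basis τ (MonoidAlgebra ℂ G) M) (c : Basis σ (MonoidAlgebra ℂ G) N) :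
    lambdaOp b c (0 : M →ₗ[MonoidAlgebra ℂ G] N) = 0 := by
  ext x j : 2
  simp [lambdaOp, L2.rightMul]

/-- The map `M → L²(G) ⊗_{ℂ[G]} M = ⨁_b L²(G)`, `∑ a_b b ↦ (a_b)`, where `ℂ[G] ⊆ L²(G)`. -/
def toL2Sum (b : Basis τ (MonoidAlgebra ℂ G) M) (m : M) : L2Sum G τ :=
  WithLp.toLp 2 fun i => L2.rightMul (b.repr m i) (L2.one G)

/-- `Λ(f)` extends `f`. -/
theorem lambdaOp_toL2Sum (b : Basis τ (MonoidAlgebra ℂ G) M) (c : Basis σ (MonoidAlgebra ℂ G) N)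
    (f : M →ₗ[MonoidAlgebra ℂ G] N) (m : M) :
    lambdaOp b c f (toL2Sum b m) = toL2Sum c (f m) := by
  ext j : 1
  have h : c.repr (f m) j = ∑ i, b.repr m i * c.repr (f (b i)) j := by
    calc c.repr (f m) j = c.repr (f (∑ i, b.repr m i • b i)) j := by rw [b.sum_repr]
      _ = _ := by
          rw [map_sum, map_sum, Finsupp.finsetSum_apply]
          simp only [map_smul, Finsupp.smul_apply, smul_eq_mul]
  simp [lambdaOp, toL2Sum, h, L2.rightMul_sum, L2.rightMul_mul]

end Lambda

/-- A finite Hilbert `𝒩(G)`-chain complex, indexed by `ℤ`, whose chain modules are finite Hilbert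
sums of copies of `L²(G)`. -/
structure HilbertComplex (G : Type w) [Group G] where
  ι : ℤ → Type w₁
  fintypeι : ∀ n, Fintype (ι n)
  d : ∀ i j, L2Sum G (ι i) →L[ℂ] L2Sum G (ι j)
  equivariant : ∀ i j (h : G) (x : L2Sum G (ι i)), d i j (L2Sum.left h x) = L2Sum.left h (d i j x)
  shape : ∀ i j, j + 1 ≠ i → d i j = 0
  d_comp_d : ∀ i j k, d j k ∘L d i j = 0
  bounded : ∃ N : ℤ, ∀ n, N < |n| → IsEmpty (ι n)

attribute [instance] HilbertComplex.fintypeι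

/-- The Hilbert chain complex `Λ(C_*) = L²(G) ⊗_{ℂ[G]} C_*`. -/
def BasedComplex.lambda (C : BasedComplex.{u, w, w₁} G) : HilbertComplex.{w, w₁} G where
  ι := C.ι
  fintypeι := C.fintypeι
  d i j := lambdaOp (C.basis i) (C.basis j) (C.cx.d i j).hom
  equivariant i j := L2Sum.matrixOp_left _
  shape i j hij := by
    rw [C.cx.shape i j hij, ModuleCat.hom_zero, lambdaOp_zero]
  d_comp_d i j k := by
    rw [← lambdaOp_comp, ← ModuleCat.hom_comp, C.cx.d_comp_d, ModuleCat.hom_zero, lambdaOp_zero]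
  bounded := by
    obtain ⟨N, hN⟩ := C.bounded
    refine ⟨N, fun n hn => ⟨fun i => ?_⟩⟩
    have := hN n hn
    exact (C.basis n).ne_zero i (Subsingleton.elim _ _)

/-! ### `L²`-invariants -/

section Invariants

variable {τ : Type w₁} {σ : Type w₂} [Fintype τ] [Fintype σ]

open Classical in
/-- The element `eᵢ` of `⨁ L²(G)` whose `i`-th entry is the unit of `G` and whose other entries are
zero. -/
def L2Sum.unit (i : τ) : L2Sum G τ := PiLp.single 2 i (L2.one G)

/-- The von Neumann dimension `dim_{𝒩(G)}(L) = tr_{𝒩(G)}(pr_L) = ∑ᵢ ⟨eᵢ, pr_L eᵢ⟩` of a closed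
`G`-invariant subspace `L` of `⨁ L²(G)`. (A subspace which is not closed is replaced by its closure;
the summands are real.) -/
def vnDim (L : Submodule ℂ (L2Sum G τ)) : ℝ :=
  ∑ i, RCLike.re ⟪L2Sum.unit i, L.topologicalClosure.starProjection (L2Sum.unit i)⟫_ℂ

/-- The Hilbert `𝒩(G)`-submodules of `⨁ L²(G)`: closed `G`-invariant subspaces. -/
def IsHilbertSubmodule (L : Submodule ℂ (L2Sum G τ)) : Prop :=
  IsClosed (L : Set (L2Sum G τ)) ∧ ∀ (h : G), ∀ x ∈ L, L2Sum.left h x ∈ L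

/-- The spectral density function of the restriction of `f` to `K`: its value at `r ≥ 0` is the
supremum of `dim_{𝒩(G)}(L)` over the Hilbert submodules `L ⊆ K` with `‖f x‖ ≤ r ‖x‖` on `L`. (For
`r < 0` only `L = 0` qualifies, so that the value is `0`.) -/
def spectralDensity (f : L2Sum G τ →L[ℂ] L2Sum G σ) (K : Submodule ℂ (L2Sum G τ)) (r : ℝ) : ℝ :=
  sSup {t | ∃ L : Submodule ℂ (L2Sum G τ), IsHilbertSubmodule L ∧ L ≤ K ∧
    (∀ x ∈ L, ‖f x‖ ≤ r * ‖x‖) ∧ t = vnDim L}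

theorem vnDim_le (L : Submodule ℂ (L2Sum G τ)) : vnDim L ≤ Fintype.card τ := by
  unfold vnDim
  refine (Finset.sum_le_card_nsmul Finset.univ _ 1 fun i _ => ?_).trans (by simp)
  refine (RCLike.re_le_norm _).trans ((norm_inner_le_norm _ _).trans ?_)
  have h1 : ‖(L2Sum.unit i : L2Sum G τ)‖ = 1 := by
    rw [L2Sum.unit, PiLp.norm_single, L2.norm_unit]
  have h2 := L.topologicalClosure.norm_starProjection_apply_le (L2Sum.unit i : L2Sum G τ)
  rw [h1] at h2
  rw [h1, one_mul]
  exact h2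

theorem spectralDensity_bddAbove (f : L2Sum G τ →L[ℂ] L2Sum G σ) (K : Submodule ℂ (L2Sum G τ))
    (r : ℝ) : BddAbove {t | ∃ L : Submodule ℂ (L2Sum G τ), IsHilbertSubmodule L ∧ L ≤ K ∧
      (∀ x ∈ L, ‖f x‖ ≤ r * ‖x‖) ∧ t = vnDim L} :=
  ⟨Fintype.card τ, by rintro _ ⟨L, -, -, -, rfl⟩; exact vnDim_le L⟩

theorem spectralDensity_mono (f : L2Sum G τ →L[ℂ] L2Sum G σ) (K : Submodule ℂ (L2Sum G τ)) :
    Monotone (spectralDensity f K) := by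
  intro r s hrs
  refine csSup_le_csSup (spectralDensity_bddAbove f K s) ?_ ?_
  · refine ⟨vnDim (⊥ : Submodule ℂ (L2Sum G τ)), ⊥, ⟨?_, ?_⟩, bot_le, ?_, rfl⟩
    · simp
    · intro h x hx
      rw [Submodule.mem_bot] at hx ⊢
      subst hx
      ext i : 1
      simp [L2Sum.left]
    · intro x hx
      rw [Submodule.mem_bot] at hx
      simp [hx]
  · rintro _ ⟨L, hL, hK, hf, rfl⟩
    exact ⟨L, hL, hK, fun x hx => (hf x hx).trans (by gcongr), rfl⟩

/-- The Lebesgue–Stieltjes measure `dF` of the spectral density function `F` of `f`. -/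
def spectralMeasure (f : L2Sum G τ →L[ℂ] L2Sum G σ) : MeasureTheory.Measure ℝ :=
  (spectralDensity_mono f ⊤).stieltjesFunction.measure

/-- `f` is of determinant class: `∫_{0+}^∞ ln(λ) dF > -∞`. As `F` is bounded, and constant on
`[‖f‖, ∞)`, this says that `ln` is `dF`-integrable on `(0, ∞)`. -/
def IsDetClass (f : L2Sum G τ →L[ℂ] L2Sum G σ) : Prop :=
  MeasureTheory.IntegrableOn Real.log (Set.Ioi 0) (spectralMeasure f)

open Classical in
/-- The Fuglede–Kadison determinant: `exp(∫_{0+}^∞ ln(λ) dF)` if `f` is of determinant class, and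
`0` otherwise. -/
def fkDet (f : L2Sum G τ →L[ℂ] L2Sum G σ) : ℝ :=
  if IsDetClass f then Real.exp (∫ r in Set.Ioi 0, Real.log r ∂(spectralMeasure f)) else 0

open Classical in
/-- The Novikov–Shubin invariant of a density function `F`:
`liminf_{r → 0+} ln(F(r) - F(0)) / ln(r) ∈ [0, ∞]` if `F(r) > F(0)` for all `r > 0`, and otherwise
the extra symbol `∞⁺`, which is `⊤ : WithTop EReal`. -/
def novikovShubin (F : ℝ → ℝ) : WithTop EReal :=
  if ∀ r > 0, F 0 < F r then
    ((liminf (fun r : ℝ => ((Real.log (F r - F 0) / Real.log r : ℝ) : EReal)) (𝓝[>] 0) : EReal) :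
      WithTop EReal)
  else ⊤

end Invariants

namespace HilbertComplex

variable (C : HilbertComplex.{w, w₁} G)

/-- The spectral density function `F_n(C_*)`: that of `c_n` restricted to `im(c_{n+1})^⊥`. -/
def specDensity (n : ℤ) : ℝ → ℝ :=
  spectralDensity (C.d n (n - 1)) (LinearMap.range (C.d (n + 1) n).toLinearMap)ᗮ

/-- The `L²`-Betti number `b_n^{(2)}(C_*)`: the von Neumann dimension of the reduced `L²`-homology
`ker(c_n) / closure(im(c_{n+1}))`, whose Hilbert space structure is that of the orthogonal
complement of `im(c_{n+1})` in `ker(c_n)`. -/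
def betti (n : ℤ) : ℝ :=
  vnDim (LinearMap.ker (C.d n (n - 1)).toLinearMap ⊓
    (LinearMap.range (C.d (n + 1) n).toLinearMap)ᗮ)

/-- The `n`-th Novikov–Shubin invariant `α_n(C_*)`. -/
def alpha (n : ℤ) : WithTop EReal := novikovShubin (C.specDensity n)

/-- `C_*` is of determinant class if all its differentials are. -/
def IsDeterminantClass : Prop := ∀ n : ℤ, IsDetClass (C.d n (n - 1))

/-- The `L²`-torsion `ρ^{(2)}(C_*) = -∑ (-1)^n ln(det(c_n))` (a finite sum, as `C_*` is bounded). -/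
def torsion : ℝ := -∑ᶠ n : ℤ, (-1 : ℝ) ^ n * Real.log (fkDet (C.d n (n - 1)))

end HilbertComplex

end Hilbert

end L2Twist

end

/-! The proof untwists the diagonal action. In the given bases, an element of `L²(G) ⊗ (M ⊗ V)_d` is
a family of functions on `G` with values in `V`, and `x ↦ (g ↦ ρ(g) x(g))` identifies this space
with `(L²(G) ⊗ M) ⊗ V`. Unitarity of `ρ` makes the identification isometric, and the cocycle rule
`ρ(g) ρ(h⁻¹) = ρ(g h⁻¹)` turns `Λ(f ⊗ id_V)` into `Λ(f) ⊗ id_V` (`untwist_lambdaOp_twistMap`). The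
group action becomes `h ⊗ ρ(h)`, so it mixes the `V`-components by scalars. Hence `L ⊗ V` is a
Hilbert submodule whenever `L` is one, and its dimension is `dim V · dim L`
(`vnDim_twistSubmodule`). Kernels and orthogonal complements of ranges are carried to such tensor
products, which gives the Betti numbers.

The difficulty for spectral densities is that the supremum on the twisted side runs over all Hilbert
submodules, not only those of the form `L ⊗ V`. It is resolved by a maximizer that is visibly
compatible with twisting: a subspace `E` of `K` on which `‖f x‖ ≤ r ‖x‖`, and such that the opposite
strict inequality holds for nonzero vectors of `K` orthogonal to `E`. Functional calculus provides
an invariant such `E` (`exists_isSpectralSubspace`), and `E ⊗ V` has the same property for the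
twisted operator (`IsSpectralSubspace.twist`). Any competitor `L` meets `Eᗮ` trivially, and then
`dim L ≤ dim E` (`vnDim_le_of_inf_orthogonal_eq_bot`). This comparison uses only cyclicity of the
trace on equivariant operators and the mean ergodic theorem; no polar decomposition is involved.

Novikov–Shubin invariants, determinant class and torsion depend only on the density functions, so it
remains to see how they react to a constant factor. -/

noncomputable section

namespace L2Twist

universe u u' v w w₁ w₂

/-! ### Equivariant operators and cyclicity of the von Neumann trace -/

section Trace

variable {G : Type w} [Group G] {τ : Type w₁} {σ : Type w₂} [Fintype τ] [Fintype σ]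

/-- Left translation on `⨁ L²(G)`, as a linear isometry. -/
def L2Sum.leftIsometry (h : G) : L2Sum G τ →ₗᵢ[ℂ] L2Sum G τ where
  toFun := L2Sum.left h
  map_add' x y := by
    ext i : 1
    simp [L2Sum.left]
  map_smul' t x := by
    ext i : 1
    simp [L2Sum.left]
  norm_map' x := by
    have h1 : ∀ i, ‖L2.left h (x i)‖ = ‖x i‖ := fun i => (L2.reindex _).norm_map (x i)
    change ‖L2Sum.left h x‖ = ‖x‖
    rw [PiLp.norm_eq_of_L2, PiLp.norm_eq_of_L2]
    simp [L2Sum.left, h1]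

theorem L2Sum.leftIsometry_apply (h : G) (x : L2Sum G τ) :
    L2Sum.leftIsometry h x = L2Sum.left h x := rfl

theorem L2Sum.left_left (h k : G) (x : L2Sum G τ) :
    L2Sum.left h (L2Sum.left k x) = L2Sum.left (h * k) x := by
  ext i g
  simp [L2Sum.left, mul_assoc]

theorem L2Sum.left_one (x : L2Sum G τ) : L2Sum.left 1 x = x := by
  ext i g
  simp [L2Sum.left]

theorem L2Sum.left_sub (h : G) (x y : L2Sum G τ) :
    L2Sum.left h (x - y) = L2Sum.left h x - L2Sum.left h y :=
  map_sub (L2Sum.leftIsometry h) x y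

theorem L2Sum.inner_left (h : G) (x y : L2Sum G τ) :
    ⟪L2Sum.left h x, y⟫_ℂ = ⟪x, L2Sum.left h⁻¹ y⟫_ℂ := by
  have h1 : y = L2Sum.left h (L2Sum.left h⁻¹ y) := by
    rw [L2Sum.left_left, mul_inv_cancel, L2Sum.left_one]
  conv_lhs => rw [h1]
  exact (L2Sum.leftIsometry h).inner_map_map _ _

open Classical in
theorem L2Sum.unit_apply (i j : τ) (g : G) :
    (L2Sum.unit i : L2Sum G τ) j g = if j = i ∧ g = 1 then 1 else 0 := by
  by_cases hj : j = i
  · subst hj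
    simp [L2Sum.unit, L2.one, lp.single_apply, Pi.single_apply]
  · simp [L2Sum.unit, hj]

theorem L2Sum.inner_unit (i : τ) (x : L2Sum G τ) : ⟪L2Sum.unit i, x⟫_ℂ = x i 1 := by
  classical
  rw [PiLp.inner_apply, Finset.sum_eq_single i]
  · have h1 : (L2Sum.unit i : L2Sum G τ) i = L2.one G := by simp [L2Sum.unit]
    rw [h1, L2.one, lp.inner_single_left]
    simp
  · intro j _ hj
    have h1 : (L2Sum.unit i : L2Sum G τ) j = 0 := by simp [L2Sum.unit, hj]
    rw [h1, inner_zero_left]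
  · simp

theorem L2Sum.inner_left_unit (i : τ) (h : G) (x : L2Sum G τ) :
    ⟪L2Sum.left h (L2Sum.unit i), x⟫_ℂ = x i h := by
  rw [L2Sum.inner_left, L2Sum.inner_unit]
  simp [L2Sum.left]

/-- `A` commutes with the `G`-actions. -/
def IsEquivariant (A : L2Sum G τ →L[ℂ] L2Sum G σ) : Prop :=
  ∀ (h : G) (x : L2Sum G τ), A (L2Sum.left h x) = L2Sum.left h (A x)

/-- The von Neumann trace `∑ᵢ ⟨eᵢ, A eᵢ⟩`. -/
def vnTrace (A : L2Sum G τ →L[ℂ] L2Sum G τ) : ℂ :=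
  ∑ i, ⟪L2Sum.unit i, A (L2Sum.unit i)⟫_ℂ

theorem vnTrace_sub (A B : L2Sum G τ →L[ℂ] L2Sum G τ) :
    vnTrace (A - B) = vnTrace A - vnTrace B := by
  simp [vnTrace]

theorem IsEquivariant.coord_adjoint {A : L2Sum G τ →L[ℂ] L2Sum G τ} (hA : IsEquivariant A)
    (i j : τ) (g : G) :
    (starRingEnd ℂ) ((ContinuousLinearMap.adjoint A) (L2Sum.unit i) j g) =
      A (L2Sum.unit j) i g⁻¹ := by
  rw [← L2Sum.inner_left_unit, inner_conj_symm, ContinuousLinearMap.adjoint_inner_left, hA,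
    L2Sum.inner_unit]
  simp [L2Sum.left]

/-- Each diagonal term is `⟨A* eᵢ, B eᵢ⟩`, expanded over components and group elements. Equivariance
of `A` turns the entries of `A*` back into entries of `A` at the inverse group element. -/
theorem IsEquivariant.vnTrace_mul {A : L2Sum G τ →L[ℂ] L2Sum G τ} (hA : IsEquivariant A)
    (B : L2Sum G τ →L[ℂ] L2Sum G τ) :
    vnTrace (A * B) =
      ∑ i, ∑ j, ∑' g, A (L2Sum.unit j) i g⁻¹ * B (L2Sum.unit i) j g := by
  refine Finset.sum_congr rfl fun i _ => ?_
  rw [mul_apply_eq_comp, ← ContinuousLinearMap.adjoint_inner_left, PiLp.inner_apply]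
  refine Finset.sum_congr rfl fun j _ => ?_
  rw [lp.inner_eq_tsum]
  refine tsum_congr fun g => ?_
  rw [RCLike.inner_apply, hA.coord_adjoint, mul_comm]

/-- The expansion of `vnTrace_mul` is symmetric under exchanging `i` with `j` and `g` with `g⁻¹`.
Only the finite sums are interchanged, so no question of convergence arises. -/
theorem IsEquivariant.vnTrace_mul_comm {A B : L2Sum G τ →L[ℂ] L2Sum G τ} (hA : IsEquivariant A)
    (hB : IsEquivariant B) : vnTrace (A * B) = vnTrace (B * A) := by
  rw [hA.vnTrace_mul, hB.vnTrace_mul, Finset.sum_comm]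
  refine Finset.sum_congr rfl fun j _ => Finset.sum_congr rfl fun i _ => ?_
  rw [← (Equiv.inv G).tsum_eq]
  refine tsum_congr fun g => ?_
  rw [Equiv.inv_apply, inv_inv, mul_comm]

theorem isEquivariant_one : IsEquivariant (1 : L2Sum G τ →L[ℂ] L2Sum G τ) := fun _ _ => rfl

theorem IsEquivariant.mul {A B : L2Sum G τ →L[ℂ] L2Sum G τ} (hA : IsEquivariant A)
    (hB : IsEquivariant B) : IsEquivariant (A * B) := fun h x => by
  rw [mul_apply_eq_comp, hB, hA, mul_apply_eq_comp]

theorem IsEquivariant.sub {A B : L2Sum G τ →L[ℂ] L2Sum G τ} (hA : IsEquivariant A)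
    (hB : IsEquivariant B) : IsEquivariant (A - B) := fun h x => by
  rw [sub_apply, hB, hA, sub_apply, L2Sum.left_sub]

theorem IsEquivariant.pow {A : L2Sum G τ →L[ℂ] L2Sum G τ} (hA : IsEquivariant A) (n : ℕ) :
    IsEquivariant (A ^ n) := by
  induction n with
  | zero => simpa using isEquivariant_one
  | succ n ih => rw [pow_succ]; exact ih.mul hA

theorem IsEquivariant.adjoint {A : L2Sum G τ →L[ℂ] L2Sum G σ} (hA : IsEquivariant A) :
    IsEquivariant (ContinuousLinearMap.adjoint A) := fun h x => by
  refine ext_inner_left ℂ fun y => ?_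
  have h1 : ∀ z w : L2Sum G τ, ⟪z, L2Sum.left h w⟫_ℂ = ⟪L2Sum.left h⁻¹ z, w⟫_ℂ := fun z w => by
    rw [L2Sum.inner_left, inv_inv]
  rw [h1, ContinuousLinearMap.adjoint_inner_right, ContinuousLinearMap.adjoint_inner_right, hA,
    L2Sum.inner_left, inv_inv]

theorem IsHilbertSubmodule.orthogonal_mem {L : Submodule ℂ (L2Sum G τ)}
    (hL : IsHilbertSubmodule L) (h : G) {x : L2Sum G τ} (hx : x ∈ Lᗮ) : L2Sum.left h x ∈ Lᗮ := by
  rw [Submodule.mem_orthogonal'] at hx ⊢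
  intro y hy
  rw [L2Sum.inner_left]
  exact hx _ (hL.2 _ _ hy)

theorem IsHilbertSubmodule.isEquivariant {L : Submodule ℂ (L2Sum G τ)}
    [L.HasOrthogonalProjection] (hL : IsHilbertSubmodule L) : IsEquivariant L.starProjection := by
  intro h x
  refine (Submodule.eq_starProjection_of_mem_orthogonal
    (hL.2 h _ (L.starProjection_apply_mem x)) ?_)
  rw [← L2Sum.left_sub]
  exact hL.orthogonal_mem h (L.sub_starProjection_mem_orthogonal x)

theorem IsHilbertSubmodule.hasOrthogonalProjection {L : Submodule ℂ (L2Sum G τ)}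
    (hL : IsHilbertSubmodule L) : L.HasOrthogonalProjection :=
  have : CompleteSpace L := hL.1.completeSpace_coe
  inferInstance

theorem vnDim_eq {L : Submodule ℂ (L2Sum G τ)} [L.HasOrthogonalProjection]
    (hL : IsClosed (L : Set (L2Sum G τ))) : vnDim L = (vnTrace L.starProjection).re := by
  have h1 : L.topologicalClosure = L := hL.submodule_topologicalClosure_eq
  have h2 : ∀ (L' : Submodule ℂ (L2Sum G τ)) [L'.HasOrthogonalProjection], L' = L →
      L'.starProjection = L.starProjection := by
    intro L' _ h
    subst h
    rfl
  rw [vnDim, vnTrace, Complex.re_sum, h2 _ h1]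
  rfl

/-- A polynomial in `a * b` without constant term factors as `a · s · b` with `s` a polynomial in `b
* a`. In this form a cyclic trace can move `a` to the other end. -/
theorem one_sub_one_sub_mul_pow {R : Type*} [Ring R] (a b : R) (n : ℕ) :
    1 - (1 - a * b) ^ n = a * (∑ k ∈ Finset.range n, (1 - b * a) ^ k) * b := by
  have h1 : ∀ k, (1 - b * a) ^ k * b = b * (1 - a * b) ^ k := fun k => by
    have h : SemiconjBy b (1 - a * b) (1 - b * a) := by
      simp only [SemiconjBy]; noncomm_ring
    exact (h.pow_right k).eq.symm
  rw [mul_assoc, Finset.sum_mul, Finset.sum_congr rfl fun k _ => h1 k, ← Finset.mul_sum,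
    ← mul_assoc]
  have h2 := mul_neg_geom_sum (1 - a * b) n
  rw [← h2]
  noncomm_ring

end Trace

/-! ### Two projections: positivity bounds and the mean ergodic theorem -/

section Comparison

variable {H : Type*} [NormedAddCommGroup H] [InnerProductSpace ℂ H]

/-- Induction in steps of two avoids square roots: `⟪y, T ^ (n + 2) y⟫ = ⟪T y, T ^ n (T y)⟫`. -/
theorem re_inner_pow_nonneg {T : H →L[ℂ] H} (hT : (T : H →ₗ[ℂ] H).IsSymmetric)
    (h0 : ∀ y, 0 ≤ (⟪y, T y⟫_ℂ).re) (n : ℕ) (y : H) : 0 ≤ (⟪y, (T ^ n) y⟫_ℂ).re := by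
  induction n using Nat.twoStepInduction generalizing y with
  | zero => simpa using inner_self_nonneg (𝕜 := ℂ) (x := y)
  | one => simpa using h0 y
  | more n ih _ =>
    have h1 : (T ^ (n + 2)) y = T ((T ^ n) (T y)) := by
      rw [← mul_apply_eq_comp, ← mul_apply_eq_comp, mul_assoc, ← pow_succ, ← pow_succ']
    have h2 : ⟪y, T ((T ^ n) (T y))⟫_ℂ = ⟪T y, (T ^ n) (T y)⟫_ℂ := (hT _ _).symm
    rw [h1, h2]
    exact ih _

variable {L E : Submodule ℂ H} [L.HasOrthogonalProjection] [E.HasOrthogonalProjection]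

theorem inner_starProjection_mul (x : H) :
    (⟪x, (L.starProjection * E.starProjection * L.starProjection) x⟫_ℂ) =
      ((‖E.starProjection (L.starProjection x)‖ ^ 2 : ℝ) : ℂ) := by
  have h1 : ⟪x, L.starProjection (E.starProjection (L.starProjection x))⟫_ℂ =
      ⟪L.starProjection x, E.starProjection (L.starProjection x)⟫_ℂ :=
    (L.starProjection_isSymmetric _ _).symm
  have h2 : ⟪L.starProjection x, E.starProjection (L.starProjection x)⟫_ℂ =
      ⟪E.starProjection (L.starProjection x), E.starProjection (L.starProjection x)⟫_ℂ := by
    have := E.starProjection_isSymmetric (L.starProjection x)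
      (E.starProjection (L.starProjection x))
    simp only [ContinuousLinearMap.coe_coe] at this
    rw [this, E.starProjection_eq_self_iff.2 (E.starProjection_apply_mem _)]
  rw [mul_apply_eq_comp, mul_apply_eq_comp, h1, h2, inner_self_eq_norm_sq_to_K]
  norm_cast

/-- With `S = PQP`, one has `‖x - S x‖² = ‖x‖² - 2 ‖Q P x‖² + ‖S x‖²` and `‖S x‖ ≤ ‖Q P x‖`. The
contraction bound is what the mean ergodic theorem requires. -/
theorem norm_one_sub_starProjection_mul_le :
    ‖1 - L.starProjection * E.starProjection * L.starProjection‖ ≤ 1 := by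
  refine ContinuousLinearMap.opNorm_le_bound _ zero_le_one fun x => ?_
  rw [one_mul, sub_apply, one_apply_eq_self]
  refine le_of_sq_le_sq ?_ (norm_nonneg _)
  rw [@norm_sub_sq ℂ, inner_starProjection_mul]
  have h1 : ‖(L.starProjection * E.starProjection * L.starProjection) x‖ ≤
      ‖E.starProjection (L.starProjection x)‖ := L.norm_starProjection_apply_le _
  have h2 := pow_le_pow_left₀ (norm_nonneg _) h1 2
  simp only [RCLike.re_to_complex, Complex.ofReal_re]
  nlinarith [sq_nonneg ‖E.starProjection (L.starProjection x)‖]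

/-- The operator `T = 1 - QPQ` is the identity on `Eᗮ` and commutes with `Q`, so `1 - T ^ n = Q - Q
T ^ n Q`. The subtracted term is nonnegative because `T` is. -/
theorem re_inner_one_sub_pow_le (n : ℕ) (x : H) :
    (⟪x, (1 - (1 - E.starProjection * L.starProjection * E.starProjection) ^ n) x⟫_ℂ).re ≤
      (⟪x, E.starProjection x⟫_ℂ).re := by
  set Q := E.starProjection with hQ
  set P := L.starProjection with hP
  set T := 1 - Q * P * Q with hT
  have hQQ : Q * Q = Q := E.isIdempotentElem_starProjection
  have h1 : T ^ n * (1 - Q) = 1 - Q := by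
    induction n with
    | zero => simp
    | succ n ih =>
      have h : T * (1 - Q) = 1 - Q := by
        have : Q * P * Q * (1 - Q) = 0 := by
          rw [mul_assoc, mul_sub, hQQ, mul_one, sub_self, mul_zero]
        rw [hT, sub_mul, this, one_mul, sub_zero]
      rw [pow_succ, mul_assoc, h, ih]
  have hc : Commute Q T := by
    refine (Commute.one_right Q).sub_right ?_
    change Q * (Q * P * Q) = Q * P * Q * Q
    rw [mul_assoc (Q * P), hQQ, ← mul_assoc, ← mul_assoc, hQQ]
  have h2 : 1 - T ^ n = Q - Q * T ^ n * Q := by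
    have : T ^ n = T ^ n * (1 - Q) + T ^ n * Q := by rw [← mul_add, sub_add_cancel, mul_one]
    rw [this, h1, mul_add, add_mul, ← mul_assoc, (hc.pow_right n).eq]
    simp only [mul_sub, mul_one, hQQ, sub_self, zero_mul, zero_add, mul_assoc]
    abel
  have hsymm : (T : H →ₗ[ℂ] H).IsSymmetric := by
    intro y z
    have e1 := fun y z => E.starProjection_isSymmetric y z
    have e2 := fun y z => L.starProjection_isSymmetric y z
    simp only [ContinuousLinearMap.coe_coe] at e1 e2 ⊢
    simp only [hT, hQ, hP, sub_apply, one_apply_eq_self, mul_apply_eq_comp, inner_sub_left,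
      inner_sub_right, e1, e2]
  have h3 : ∀ y, 0 ≤ (⟪y, T y⟫_ℂ).re := by
    intro y
    have h4 : ‖L.starProjection (E.starProjection y)‖ ≤ ‖y‖ :=
      (L.norm_starProjection_apply_le _).trans (E.norm_starProjection_apply_le _)
    have h5 := pow_le_pow_left₀ (norm_nonneg _) h4 2
    rw [hT, sub_apply, inner_sub_right, inner_starProjection_mul, one_apply_eq_self,
      inner_self_eq_norm_sq_to_K, Complex.sub_re, Complex.ofReal_re]
    have : ((RCLike.ofReal ‖y‖ : ℂ) ^ 2).re = ‖y‖ ^ 2 := by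
      change (((‖y‖ : ℝ) : ℂ) ^ 2).re = _
      norm_cast
    rw [this]
    linarith
  rw [h2, sub_apply, inner_sub_right, Complex.sub_re, mul_apply_eq_comp, mul_apply_eq_comp]
  have h6 : ⟪x, Q ((T ^ n) (Q x))⟫_ℂ = ⟪Q x, (T ^ n) (Q x)⟫_ℂ :=
    (E.starProjection_isSymmetric _ _).symm
  rw [h6]
  linarith [re_inner_pow_nonneg hsymm h3 n (Q x)]

/-- The averages converge to the projection onto the fixed space of `1 - PQP`, that is, onto the
kernel of `PQP`. If `PQP y = 0` then `Q P y = 0`, so `P y` lies in `L ⊓ Eᗮ = ⊥`; hence this kernel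
is `Lᗮ`. -/
theorem tendsto_average_one_sub_starProjection [CompleteSpace H] (h : L ⊓ Eᗮ = ⊥) (x : H) :
    Tendsto (fun N : ℕ => (N : ℂ)⁻¹ • ∑ n ∈ Finset.range N,
      ((1 - L.starProjection * E.starProjection * L.starProjection) ^ n) x) atTop
      (𝓝 (x - L.starProjection x)) := by
  set S := L.starProjection * E.starProjection * L.starProjection with hS
  have h1 := (1 - S).tendsto_birkhoffAverage_orthogonalProjection
    norm_one_sub_starProjection_mul_le x
  have h2 : (1 - S).eqLocus (1 : H →L[ℂ] H) = Lᗮ := by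
    ext y
    have h3 : y ∈ (1 - S).eqLocus (1 : H →L[ℂ] H) ↔ S y = 0 := by
      simp [LinearMap.mem_eqLocus]
    rw [h3, ← L.starProjection_apply_eq_zero_iff]
    constructor
    · intro hy
      have h4 := inner_starProjection_mul (L := L) (E := E) y
      rw [← hS, hy, inner_zero_right] at h4
      have h5 : E.starProjection (L.starProjection y) = 0 := by
        have : ‖E.starProjection (L.starProjection y)‖ ^ 2 = 0 := by exact_mod_cast h4.symm
        simpa using this
      have h6 : L.starProjection y ∈ L ⊓ Eᗮ :=
        ⟨L.starProjection_apply_mem y, E.starProjection_apply_eq_zero_iff.1 h5⟩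
      rwa [h, Submodule.mem_bot] at h6
    · intro hy
      rw [hS, mul_apply_eq_comp, hy, map_zero]
  have h7 : ∀ (K K' : Submodule ℂ H) [K.HasOrthogonalProjection] [K'.HasOrthogonalProjection],
      K = K' → (K.orthogonalProjectionOnto x : H) = K'.starProjection x := by
    intro K K' _ _ h
    subst h
    rfl
  rw [h7 _ _ h2, L.starProjection_orthogonal, sub_apply] at h1
  refine h1.congr fun N => ?_
  simp only [birkhoffAverage, birkhoffSum, id_eq]
  congr 1
  refine Finset.sum_congr rfl fun n hn => ?_
  clear hn
  induction n with
  | zero => simp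
  | succ n ih => rw [Function.iterate_succ_apply', ih, pow_succ', mul_apply_eq_comp]

end Comparison

/-! ### Comparison of von Neumann dimensions -/

section Dimension

variable {G : Type w} [Group G] {τ : Type w₁} {σ : Type w₂} [Fintype τ] [Fintype σ]

theorem IsEquivariant.sum {υ : Type*} (s : Finset υ) {A : υ → L2Sum G τ →L[ℂ] L2Sum G τ}
    (hA : ∀ k ∈ s, IsEquivariant (A k)) : IsEquivariant (∑ k ∈ s, A k) := fun h x => by
  rw [sum_apply, sum_apply, ← L2Sum.leftIsometry_apply h (∑ i ∈ s, A i x), map_sum]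
  exact Finset.sum_congr rfl fun k hk => hA k hk h x

theorem IsEquivariant.vnTrace_one_sub_pow {A B : L2Sum G τ →L[ℂ] L2Sum G τ}
    (hA : IsEquivariant A) (hB : IsEquivariant B) (n : ℕ) :
    vnTrace (1 - (1 - A * B) ^ n) = vnTrace (1 - (1 - B * A) ^ n) := by
  rw [one_sub_one_sub_mul_pow, mul_assoc, hA.vnTrace_mul_comm, mul_assoc, ← geom_sum_mul_neg,
    sub_sub_cancel]
  refine (IsEquivariant.sum _ fun k _ => ?_).mul hB
  exact (isEquivariant_one.sub (hB.mul hA)).pow k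

/-- If the Hilbert submodule `L` meets the orthogonal complement of `E` trivially, then
`dim L ≤ dim E`. -/
theorem vnDim_le_of_inf_orthogonal_eq_bot {L E : Submodule ℂ (L2Sum G τ)}
    (hL : IsHilbertSubmodule L) (hE : IsHilbertSubmodule E) (h : L ⊓ Eᗮ = ⊥) :
    vnDim L ≤ vnDim E := by
  have := hL.hasOrthogonalProjection
  have := hE.hasOrthogonalProjection
  rw [vnDim_eq hL.1, vnDim_eq hE.1]
  set P := L.starProjection with hP
  set Q := E.starProjection with hQ
  set I : L2Sum G τ →L[ℂ] L2Sum G τ := 1 with hI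
  have hQQ : Q * Q = Q := E.isIdempotentElem_starProjection
  have hPP : P * P = P := L.isIdempotentElem_starProjection
  have hPe : IsEquivariant P := hL.isEquivariant
  have hQe : IsEquivariant Q := hE.isEquivariant
  -- Cyclicity is applied to `PQ` and `QP`, whose two products are `PQP` and `QPQ`. The trace of `1
  -- - (1 - PQP) ^ n` is thereby bounded by that of `Q`, uniformly in `n`.
  have h1 : ∀ n : ℕ, (vnTrace I - vnTrace Q).re ≤
      (vnTrace ((1 - P * Q * P) ^ n)).re := by
    intro n
    have h2 := (hPe.mul hQe).vnTrace_one_sub_pow (hQe.mul hPe) n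
    have e1 : P * Q * (Q * P) = P * Q * P := by rw [mul_assoc, ← mul_assoc Q Q P, hQQ, mul_assoc]
    have e2 : Q * P * (P * Q) = Q * P * Q := by rw [mul_assoc, ← mul_assoc P P Q, hPP, mul_assoc]
    rw [e1, e2, vnTrace_sub] at h2
    have h3 : (vnTrace (1 - (1 - Q * P * Q) ^ n)).re ≤ (vnTrace Q).re := by
      rw [vnTrace, vnTrace, Complex.re_sum, Complex.re_sum]
      exact Finset.sum_le_sum fun i _ => re_inner_one_sub_pow_le n _
    rw [← h2, Complex.sub_re] at h3
    rw [Complex.sub_re]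
    linarith
  have h4 : Tendsto (fun N : ℕ => (∑ i, ⟪(L2Sum.unit i : L2Sum G τ),
      (N : ℂ)⁻¹ • ∑ n ∈ Finset.range N, ((1 - P * Q * P) ^ n) (L2Sum.unit i)⟫_ℂ).re) atTop
      (𝓝 (vnTrace I - vnTrace P).re) := by
    rw [← vnTrace_sub, vnTrace]
    refine (Complex.continuous_re.tendsto _).comp (tendsto_finsetSum _ fun i _ => ?_)
    exact (tendsto_const_nhds.inner (tendsto_average_one_sub_starProjection h _))
  have h5 : (vnTrace I - vnTrace Q).re ≤ (vnTrace I - vnTrace P).re := by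
    -- The uniform bound passes to averages; `N = 0` is excluded since its average is zero by
    -- convention.
    refine ge_of_tendsto h4 (Filter.eventually_atTop.2 ⟨1, fun N hN => ?_⟩)
    have h6 : (∑ i, ⟪(L2Sum.unit i : L2Sum G τ),
        (N : ℂ)⁻¹ • ∑ n ∈ Finset.range N, ((1 - P * Q * P) ^ n) (L2Sum.unit i)⟫_ℂ) =
        ((N : ℝ)⁻¹ : ℝ) * ∑ n ∈ Finset.range N, vnTrace ((1 - P * Q * P) ^ n) := by
      simp only [inner_smul_right, inner_sum, vnTrace]
      rw [← Finset.mul_sum, Finset.sum_comm]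
      push_cast
      rfl
    rw [h6, Complex.re_ofReal_mul, Complex.re_sum]
    have h7 := Finset.card_nsmul_le_sum (Finset.range N) _ _ fun n _ => h1 n
    rw [Finset.card_range, nsmul_eq_mul] at h7
    have hN' : (0 : ℝ) < N := by exact_mod_cast hN
    calc (vnTrace I - vnTrace Q).re = (N : ℝ)⁻¹ * (N * (vnTrace I - vnTrace Q).re) := by
          field_simp
      _ ≤ _ := by gcongr
  simp only [Complex.sub_re] at h5
  linarith

end Dimension

/-! ### Spectral subspaces attain the spectral density -/

section Spectral

variable {H H' : Type*} [NormedAddCommGroup H] [InnerProductSpace ℂ H]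
  [NormedAddCommGroup H'] [InnerProductSpace ℂ H']

/-- `E ⊆ K` behaves like the spectral subspace of `|f|_K|` for the interval `[0, r]`: `f` is bounded
by `r` on `E` and strictly bounded below by `r` on the orthogonal complement of `E` in `K`. -/
structure IsSpectralSubspace (f : H →L[ℂ] H') (K : Submodule ℂ H) (r : ℝ)
    (E : Submodule ℂ H) : Prop where
  le : E ≤ K
  norm_le : ∀ x ∈ E, ‖f x‖ ≤ r * ‖x‖
  eq_zero : ∀ x ∈ K, x ∈ Eᗮ → ‖f x‖ ≤ r * ‖x‖ → x = 0

/-- The kernel of the positive part of a self-adjoint operator plays the role of a spectral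
projection, so continuous functional calculus suffices. The clause on commuting operators will give
`G`-invariance. -/
theorem exists_isSpectralSubspace [CompleteSpace H] [CompleteSpace H'] (f : H →L[ℂ] H')
    (K : Submodule ℂ H) [K.HasOrthogonalProjection] {r : ℝ} (hr : 0 ≤ r) :
    ∃ E : Submodule ℂ H, IsClosed (E : Set H) ∧ IsSpectralSubspace f K r E ∧
      ∀ A : H →L[ℂ] H, Commute A (ContinuousLinearMap.adjoint f ∘L f) →
        Commute A K.starProjection → ∀ x ∈ E, A x ∈ E := by
  set P := K.starProjection with hP
  set F : H →L[ℂ] H := ContinuousLinearMap.adjoint f ∘L f with hF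
  -- On `K` this is the compression of `f* f` minus `r²`; on `Kᗮ` it is the identity, because the
  -- coefficient `r² + 1` exceeds the subtracted `r²` by one. Hence the kernel of `N⁺` cannot leave
  -- `K`.
  set N : H →L[ℂ] H := P * F * P + ((r : ℂ) ^ 2 + 1) • (1 - P) - ((r : ℂ) ^ 2) • 1 with hN
  have hPP : P * P = P := K.isIdempotentElem_starProjection
  have hPsa : star P = P := (isStarProjection_starProjection (U := K)).isSelfAdjoint
  have hFsa : star F = F := by
    rw [ContinuousLinearMap.star_eq_adjoint, hF, ContinuousLinearMap.adjoint_comp,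
      ContinuousLinearMap.adjoint_adjoint]
  have hNsa : IsSelfAdjoint N := by
    simp [IsSelfAdjoint, hN, hPsa, hFsa, mul_assoc]
  have hcomm : ∀ A : H →L[ℂ] H, Commute A F → Commute A P → Commute A N⁺ := by
    intro A h1 h2
    have h3 : Commute A N := by
      refine Commute.sub_right (Commute.add_right ((h2.mul_right h1).mul_right h2) ?_) ?_
      · exact ((Commute.one_right A).sub_right h2).smul_right _
      · exact (Commute.one_right A).smul_right _
    rw [CFC.posPart_def]
    exact (Commute.cfcₙ_real h3.symm _).symm
  have hNx : ∀ x, (⟪x, N x⟫_ℂ).re =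
      ‖f (P x)‖ ^ 2 + (r ^ 2 + 1) * ‖x - P x‖ ^ 2 - r ^ 2 * ‖x‖ ^ 2 := by
    intro x
    have h1 : ⟪x, P (F (P x))⟫_ℂ = ((‖f (P x)‖ ^ 2 : ℝ) : ℂ) := by
      have : ⟪x, P (F (P x))⟫_ℂ = ⟪P x, F (P x)⟫_ℂ := (K.starProjection_isSymmetric _ _).symm
      rw [this, hF, ContinuousLinearMap.comp_apply, ContinuousLinearMap.adjoint_inner_right,
        inner_self_eq_norm_sq_to_K]
      norm_cast
    have h2 : ⟪x, x - P x⟫_ℂ = ((‖x - P x‖ ^ 2 : ℝ) : ℂ) := by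
      have : ⟪P x, x - P x⟫_ℂ = 0 :=
        K.sub_starProjection_mem_orthogonal x _ (K.starProjection_apply_mem x)
      have h3 : ⟪x, x - P x⟫_ℂ = ⟪x - P x, x - P x⟫_ℂ := by
        rw [inner_sub_left x (P x), this, sub_zero]
      rw [h3, inner_self_eq_norm_sq_to_K]
      norm_cast
    have h4 : ⟪x, x⟫_ℂ = ((‖x‖ ^ 2 : ℝ) : ℂ) := by
      rw [inner_self_eq_norm_sq_to_K]
      norm_cast
    simp only [hN, sub_apply, add_apply, mul_apply_eq_comp, smul_apply, one_apply_eq_self,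
      inner_sub_right _ _ ((r : ℂ) ^ 2 • x), inner_add_right, inner_smul_right, h1, h2, h4]
    norm_cast
  have hsub : N = N⁺ - N⁻ := (CFC.posPart_sub_negPart N hNsa).symm
  have hpos : (N⁺).IsPositive :=
    (ContinuousLinearMap.nonneg_iff_isPositive _).1 (CFC.posPart_nonneg N)
  have hneg : (N⁻).IsPositive :=
    (ContinuousLinearMap.nonneg_iff_isPositive _).1 (CFC.negPart_nonneg N)
  have hE : ∀ x, N⁺ x = 0 → (⟪x, N x⟫_ℂ).re ≤ 0 := by
    intro x hx
    rw [hsub, sub_apply, hx, zero_sub, inner_neg_right, Complex.neg_re, neg_nonpos]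
    exact hneg.re_inner_nonneg_right x
  have hPN : Commute P N⁺ := by
    rw [CFC.posPart_def]
    refine (Commute.cfcₙ_real (Commute.symm ?_) _).symm
    refine Commute.sub_right (Commute.add_right ?_ ?_) ?_
    · change P * (P * F * P) = P * F * P * P
      rw [mul_assoc (P * F), hPP, ← mul_assoc, ← mul_assoc, hPP]
    · exact ((Commute.one_right P).sub_right (Commute.refl P)).smul_right _
    · exact (Commute.one_right P).smul_right _
  set E : Submodule ℂ H := LinearMap.ker (N⁺).toLinearMap with hEdef
  have hmem : ∀ x, x ∈ E ↔ N⁺ x = 0 := fun x => LinearMap.mem_ker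
  have hle : E ≤ K := by
    intro x hx
    rw [hmem] at hx
    have h1 : N⁺ (x - P x) = 0 := by
      have := congrArg (fun A : H →L[ℂ] H => A x) hPN.eq
      simp only [mul_apply_eq_comp] at this
      rw [map_sub, hx, ← this, hx, map_zero, sub_zero]
    have h2 := hE _ h1
    have h3 : P (x - P x) = 0 := by
      rw [map_sub, ← mul_apply_eq_comp, hPP, sub_self]
    rw [hNx, h3, map_zero, norm_zero, sub_zero] at h2
    have h4 : ‖x - P x‖ ^ 2 = 0 := le_antisymm (by linarith) (sq_nonneg _)
    have h5 : x - P x = 0 := by simpa using h4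
    rw [sub_eq_zero.1 h5]
    exact K.starProjection_apply_mem x
  refine ⟨E, (N⁺).isClosed_ker, ⟨hle, ?_, ?_⟩, ?_⟩
  · intro x hx
    have h1 := hE x ((hmem x).1 hx)
    rw [hNx, K.starProjection_eq_self_iff.2 (hle hx), sub_self, norm_zero] at h1
    refine le_of_sq_le_sq ?_ (by positivity)
    rw [mul_pow]
    linarith
  · intro x hx hxE hfx
    -- The range of `N⁻` lies in `ker N⁺ = E`, so a vector orthogonal to `E` is killed by the
    -- symmetric operator `N⁻`.
    have h1 : N⁻ x = 0 := by
      refine ext_inner_left ℂ fun y => ?_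
      have h2 : N⁺ (N⁻ y) = 0 := by
        rw [← mul_apply_eq_comp, CFC.posPart_mul_negPart]
        rfl
      have h3 : ⟪N⁻ y, x⟫_ℂ = 0 := (E.mem_orthogonal x).1 hxE _ ((hmem _).2 h2)
      have h4 : ⟪N⁻ y, x⟫_ℂ = ⟪y, N⁻ x⟫_ℂ := hneg.isSymmetric y x
      rw [← h4, h3, inner_zero_right]
    have h5 : (⟪x, N⁺ x⟫_ℂ).re ≤ 0 := by
      have h6 : N x = N⁺ x := by
        conv_lhs => rw [hsub]
        rw [sub_apply, h1, sub_zero]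
      rw [← h6, hNx, K.starProjection_eq_self_iff.2 hx, sub_self, norm_zero]
      have := pow_le_pow_left₀ (norm_nonneg _) hfx 2
      rw [mul_pow] at this
      linarith
    -- Writing `N⁺ = B* B` upgrades the vanishing of the quadratic form to `B x = 0`. Then `x` lies
    -- in both `E` and `Eᗮ`.
    have h7 : N⁺ x = 0 := by
      obtain ⟨B, hB⟩ := (CStarAlgebra.nonneg_iff_eq_star_mul_self).1 (CFC.posPart_nonneg N)
      have h8 : (⟪x, N⁺ x⟫_ℂ).re = ‖B x‖ ^ 2 := by
        rw [hB, mul_apply_eq_comp, ContinuousLinearMap.star_eq_adjoint,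
          ContinuousLinearMap.adjoint_inner_right, inner_self_eq_norm_sq_to_K]
        norm_cast
      have h9 : ‖B x‖ ^ 2 = 0 := le_antisymm (h8 ▸ h5) (sq_nonneg _)
      have h10 : B x = 0 := by simpa using h9
      rw [hB, mul_apply_eq_comp, h10, map_zero]
    have h11 : ⟪x, x⟫_ℂ = 0 := (E.mem_orthogonal x).1 hxE _ ((hmem x).2 h7)
    exact inner_self_eq_zero.1 h11
  · intro A h1 h2 x hx
    rw [hmem] at hx ⊢
    have h3 := (hcomm A h1 h2).eq
    rw [← mul_apply_eq_comp, ← h3, mul_apply_eq_comp, hx, map_zero]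

theorem isSpectralSubspace_bot (f : H →L[ℂ] H') (K : Submodule ℂ H) {r : ℝ} (hr : r < 0) :
    IsSpectralSubspace f K r ⊥ where
  le := bot_le
  norm_le x hx := by
    rw [Submodule.mem_bot] at hx
    simp [hx]
  eq_zero x _ _ h := by
    by_contra hx
    exact absurd ((norm_nonneg _).trans h)
      (not_le.2 (mul_neg_of_neg_of_pos hr (norm_pos_iff.2 hx)))

variable {G : Type w} [Group G] {τ : Type w₁} {σ : Type w₂} [Fintype τ] [Fintype σ]

theorem isHilbertSubmodule_bot : IsHilbertSubmodule (⊥ : Submodule ℂ (L2Sum G τ)) := by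
  refine ⟨isClosed_singleton, fun h x hx => ?_⟩
  rw [Submodule.mem_bot] at hx ⊢
  rw [hx]
  exact map_zero (L2Sum.leftIsometry h)

theorem vnDim_bot : vnDim (⊥ : Submodule ℂ (L2Sum G τ)) = 0 := by
  rw [vnDim_eq isClosed_singleton]
  simp [vnTrace]

theorem exists_isHilbertSubmodule_isSpectralSubspace {f : L2Sum G τ →L[ℂ] L2Sum G σ}
    (hf : IsEquivariant f) {K : Submodule ℂ (L2Sum G τ)} (hK : IsHilbertSubmodule K) (r : ℝ) :
    ∃ E : Submodule ℂ (L2Sum G τ), IsHilbertSubmodule E ∧ IsSpectralSubspace f K r E := by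
  obtain hr | hr := lt_or_ge r 0
  · exact ⟨⊥, isHilbertSubmodule_bot, isSpectralSubspace_bot f K hr⟩
  have := hK.hasOrthogonalProjection
  obtain ⟨E, h1, h2, h3⟩ := exists_isSpectralSubspace f K hr
  refine ⟨E, ⟨h1, fun h x hx => ?_⟩, h2⟩
  refine h3 (L2Sum.leftIsometry h).toContinuousLinearMap ?_ ?_ x hx
  · ext1 y
    change L2Sum.left h (ContinuousLinearMap.adjoint f (f y)) =
      ContinuousLinearMap.adjoint f (f (L2Sum.left h y))
    rw [hf, hf.adjoint]
  · ext1 y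
    exact (hK.isEquivariant h y).symm

/-- The supremum defining the spectral density function is attained at any spectral subspace. -/
theorem IsSpectralSubspace.spectralDensity_eq {f : L2Sum G τ →L[ℂ] L2Sum G σ}
    {K E : Submodule ℂ (L2Sum G τ)} {r : ℝ} (h : IsSpectralSubspace f K r E)
    (hE : IsHilbertSubmodule E) : spectralDensity f K r = vnDim E := by
  refine IsGreatest.csSup_eq ⟨⟨E, hE, h.le, h.norm_le, rfl⟩, ?_⟩
  rintro _ ⟨L, hL, hLK, hLf, rfl⟩
  refine vnDim_le_of_inf_orthogonal_eq_bot hL hE ((Submodule.eq_bot_iff _).2 fun x hx => ?_)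
  exact h.eq_zero x (hLK hx.1) hx.2 (hLf x hx.1)

end Spectral

/-! ### Unitary matrices acting fiberwise over the group -/

section Fiberwise

variable {G : Type w} [Group G] {τ : Type w₁} [Fintype τ] {κ : Type w₂} [Fintype κ]

theorem L2.summable_norm_sq (x : L2 G) : Summable fun g => ‖x g‖ ^ 2 := by
  have h := (memℓp_gen_iff (by norm_num)).1 (lp.memℓp x)
  simpa using h

theorem L2.norm_sq_eq_tsum (x : L2 G) : ‖x‖ ^ 2 = ∑' g, ‖x g‖ ^ 2 := by
  have h := lp.norm_rpow_eq_tsum (p := 2) (by norm_num) x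
  simpa using h

theorem L2.sum_apply {υ : Type*} (s : Finset υ) (y : υ → L2 G) (g : G) :
    (∑ i ∈ s, y i) g = ∑ i ∈ s, y i g := by
  rw [lp.coeFn_sum]
  exact Finset.sum_apply (M := fun _ : G => ℂ) g _ _

theorem memℓp_fiberwise (φ : G → κ → κ → ℂ)
    (hφ : ∀ (g : G) (v : κ → ℂ), ∑ k, ‖∑ l, φ g k l * v l‖ ^ 2 = ∑ l, ‖v l‖ ^ 2)
    (x : κ → L2 G) (k : κ) :
    Memℓp (fun g => ∑ l, φ g k l * x l g) 2 := by
  rw [memℓp_gen_iff (by norm_num)]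
  have h1 : Summable fun g => ∑ l, ‖x l g‖ ^ 2 := summable_sum fun l _ => (x l).summable_norm_sq
  refine Summable.of_nonneg_of_le (fun g => by positivity) (fun g => ?_) h1
  rw [← hφ g fun l => x l g]
  simpa using Finset.single_le_sum (f := fun k => ‖∑ l, φ g k l * x l g‖ ^ 2)
    (fun k _ => by positivity) (Finset.mem_univ k)

/-- The isometry of `⨁_{τ × κ} L²(G) = ⨁_τ L²(G, ℂ^κ)` which applies the unitary matrix `φ g` to
the value at `g`. -/
def fiberwiseIsometry (φ : G → κ → κ → ℂ)
    (hφ : ∀ (g : G) (v : κ → ℂ), ∑ k, ‖∑ l, φ g k l * v l‖ ^ 2 = ∑ l, ‖v l‖ ^ 2) :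
    L2Sum G (τ × κ) →ₗᵢ[ℂ] L2Sum G (τ × κ) where
  toFun x := WithLp.toLp 2 fun p =>
    ⟨fun g => ∑ l, φ g p.2 l * x (p.1, l) g, memℓp_fiberwise φ hφ (fun l => x (p.1, l)) p.2⟩
  map_add' x y := by
    ext p g
    change ∑ l, φ g p.2 l * (x (p.1, l) g + y (p.1, l) g) =
      ∑ l, φ g p.2 l * x (p.1, l) g + ∑ l, φ g p.2 l * y (p.1, l) g
    simp only [mul_add, Finset.sum_add_distrib]
  map_smul' t x := by
    ext p g
    change ∑ l, φ g p.2 l * (t * x (p.1, l) g) = t * ∑ l, φ g p.2 l * x (p.1, l) g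
    simp only [Finset.mul_sum, mul_left_comm]
  norm_map' x := by
    refine (sq_eq_sq₀ (norm_nonneg _) (norm_nonneg _)).1 ?_
    rw [PiLp.norm_sq_eq_of_L2, PiLp.norm_sq_eq_of_L2, Fintype.sum_prod_type, Fintype.sum_prod_type]
    refine Finset.sum_congr rfl fun i _ => ?_
    simp only [L2.norm_sq_eq_tsum]
    rw [← Summable.tsum_finsetSum fun k _ => L2.summable_norm_sq _,
      ← Summable.tsum_finsetSum fun k _ => L2.summable_norm_sq _]
    exact tsum_congr fun g => hφ g fun l => x (i, l) g

theorem fiberwiseIsometry_apply (φ : G → κ → κ → ℂ)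
    (hφ : ∀ (g : G) (v : κ → ℂ), ∑ k, ‖∑ l, φ g k l * v l‖ ^ 2 = ∑ l, ‖v l‖ ^ 2)
    (x : L2Sum G (τ × κ))
    (p : τ × κ) (g : G) :
    fiberwiseIsometry φ hφ x p g = ∑ l, φ g p.2 l * x (p.1, l) g := rfl

/-- The `k`-th component of an element of `⨁_{τ × κ} L²(G)`. -/
def L2Sum.component (k : κ) : L2Sum G (τ × κ) →L[ℂ] L2Sum G τ :=
  (PiLp.continuousLinearEquiv 2 ℂ (fun _ : τ => L2 G)).symm.toContinuousLinearMap ∘L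
    ContinuousLinearMap.pi fun i => PiLp.proj 2 (fun _ : τ × κ => L2 G) (i, k)

@[simp]
theorem L2Sum.component_apply (k : κ) (x : L2Sum G (τ × κ)) (i : τ) :
    L2Sum.component k x i = x (i, k) := rfl

theorem L2Sum.inner_eq_sum_component (x y : L2Sum G (τ × κ)) :
    ⟪x, y⟫_ℂ = ∑ k, ⟪L2Sum.component k x, L2Sum.component k y⟫_ℂ := by
  simp only [PiLp.inner_apply, L2Sum.component_apply]
  rw [Fintype.sum_prod_type, Finset.sum_comm]

end Fiberwise

/-! ### Kernels and complements of ranges as Hilbert submodules -/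

section HilbertSubmodule

variable {G : Type w} [Group G]

theorem isHilbertSubmodule_top {τ : Type*} [Fintype τ] :
    IsHilbertSubmodule (⊤ : Submodule ℂ (L2Sum G τ)) :=
  ⟨isClosed_univ, fun _ _ _ => Submodule.mem_top⟩

theorem IsHilbertSubmodule.inf {τ : Type*} [Fintype τ] {L L' : Submodule ℂ (L2Sum G τ)}
    (hL : IsHilbertSubmodule L) (hL' : IsHilbertSubmodule L') : IsHilbertSubmodule (L ⊓ L') :=
  ⟨hL.1.inter hL'.1, fun h _ hx => ⟨hL.2 h _ hx.1, hL'.2 h _ hx.2⟩⟩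

theorem IsEquivariant.isHilbertSubmodule_ker {τ σ : Type*} [Fintype τ] [Fintype σ]
    {f : L2Sum G τ →L[ℂ] L2Sum G σ} (hf : IsEquivariant f) :
    IsHilbertSubmodule (LinearMap.ker f.toLinearMap) := by
  refine ⟨f.isClosed_ker, fun h x hx => ?_⟩
  rw [LinearMap.mem_ker, ContinuousLinearMap.coe_coe] at hx ⊢
  rw [hf, hx]
  exact map_zero (L2Sum.leftIsometry h)

theorem IsEquivariant.isHilbertSubmodule_orthogonal_range {τ σ : Type*} [Fintype τ] [Fintype σ]
    {f : L2Sum G τ →L[ℂ] L2Sum G σ} (hf : IsEquivariant f) :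
    IsHilbertSubmodule (LinearMap.range f.toLinearMap)ᗮ := by
  refine ⟨Submodule.isClosed_orthogonal _, fun h x hx => ?_⟩
  rw [Submodule.mem_orthogonal'] at hx ⊢
  rintro _ ⟨y, rfl⟩
  rw [L2Sum.inner_left]
  exact hx _ ⟨L2Sum.left h⁻¹ y, hf _ _⟩

end HilbertSubmodule

/-! ### Untwisting the diagonal action -/

section Untwisting

variable {G : Type w} [Group G] {τ : Type w₁} [Fintype τ] {κ : Type w₂} [Fintype κ]
variable {V : Type v} [AddCommGroup V] [Module ℂ V] (ρ : Representation ℂ G V) (c : Basis κ ℂ V)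

/-- The matrix coefficients of `ρ` in the basis `c`. -/
def repCoeff (g : G) (k l : κ) : ℂ := c.repr (ρ g (c l)) k

theorem repr_rep_eq_sum (g : G) (x : V) (k : κ) :
    c.repr (ρ g x) k = ∑ l, repCoeff ρ c g k l * c.repr x l := by
  conv_lhs => rw [← c.sum_repr x]
  simp only [repCoeff, map_sum, map_smul, Finsupp.finsetSum_apply, Finsupp.smul_apply, smul_eq_mul,
    mul_comm]

theorem repCoeff_mul (g h : G) (k m : κ) :
    repCoeff ρ c (g * h) k m = ∑ l, repCoeff ρ c g k l * repCoeff ρ c h l m := by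
  rw [repCoeff, map_mul, Module.End.mul_apply, repr_rep_eq_sum]
  rfl

open Classical in
theorem repCoeff_one (k l : κ) : repCoeff ρ c 1 k l = if k = l then 1 else 0 := by
  simp [repCoeff, Finsupp.single_apply, eq_comm]

variable {ρ c}

theorem IsUnitaryRep.sum_norm_sq (hV : IsUnitaryRep ρ c) (g : G) (v : κ → ℂ) :
    ∑ k, ‖∑ l, repCoeff ρ c g k l * v l‖ ^ 2 = ∑ l, ‖v l‖ ^ 2 := by
  have h1 := hV g (c.equivFun.symm v) (c.equivFun.symm v)
  have h2 : ∀ l, c.repr (c.equivFun.symm v) l = v l := fun l => by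
    rw [← c.equivFun_apply, LinearEquiv.apply_symm_apply]
  simp only [repr_rep_eq_sum, h2, RCLike.conj_mul] at h1
  exact_mod_cast h1

/-- `L²(G) ⊗_{ℂ[G]} (M ⊗ V)_d ≅ (L²(G) ⊗_{ℂ[G]} M) ⊗ V`, followed by the `k`-th coordinate of `V`:
in coordinates, `x ↦ (g ↦ ρ(g) x(g))_k`. -/
def untwist (hV : IsUnitaryRep ρ c) (k : κ) : L2Sum G (τ × κ) →L[ℂ] L2Sum G τ :=
  L2Sum.component k ∘L (fiberwiseIsometry (repCoeff ρ c) hV.sum_norm_sq).toContinuousLinearMap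

variable (hV : IsUnitaryRep ρ c)

theorem untwist_apply (k : κ) (x : L2Sum G (τ × κ)) (i : τ) (g : G) :
    untwist hV k x i g = ∑ l, repCoeff ρ c g k l * x (i, l) g := rfl

theorem inner_eq_sum_untwist (x y : L2Sum G (τ × κ)) :
    ⟪x, y⟫_ℂ = ∑ k, ⟪untwist hV k x, untwist hV k y⟫_ℂ := by
  rw [← (fiberwiseIsometry (repCoeff ρ c) hV.sum_norm_sq).inner_map_map x y,
    L2Sum.inner_eq_sum_component]
  rfl

theorem norm_sq_eq_sum_untwist (x : L2Sum G (τ × κ)) :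
    ‖x‖ ^ 2 = ∑ k, ‖untwist hV k x‖ ^ 2 := by
  have h := inner_eq_sum_untwist hV x x
  simp only [inner_self_eq_norm_sq_to_K] at h
  exact_mod_cast h

/-- The inverse applies `ρ(g⁻¹)` at `g`, which is again fiberwise unitary and so preserves
square-summability. -/
theorem exists_untwist_eq (y : κ → L2Sum G τ) : ∃ x, ∀ k, untwist hV k x = y k := by
  have h1 : ∀ (g : G) (v : κ → ℂ),
      ∑ k, ‖∑ l, repCoeff ρ c g⁻¹ k l * v l‖ ^ 2 = ∑ l, ‖v l‖ ^ 2 := fun g => hV.sum_norm_sq g⁻¹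
  refine ⟨fiberwiseIsometry (fun g => repCoeff ρ c g⁻¹) h1
    (WithLp.toLp 2 fun p => y p.2 p.1), fun k => ?_⟩
  classical
  ext i g
  rw [untwist_apply]
  simp only [fiberwiseIsometry_apply, Finset.mul_sum]
  rw [Finset.sum_comm]
  simp only [← mul_assoc, ← Finset.sum_mul, ← repCoeff_mul, mul_inv_cancel, repCoeff_one]
  simp

/-- Since `ρ(g) = ρ(h) ρ(h⁻¹ g)`, translation becomes `h ⊗ ρ(h)`. Components mix only by scalars,
which is why `L ⊗ V` stays invariant. -/
theorem untwist_left (k : κ) (h : G) (x : L2Sum G (τ × κ)) :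
    untwist hV k (L2Sum.left h x) =
      ∑ l, repCoeff ρ c h k l • L2Sum.left h (untwist hV l x) := by
  ext i g
  have h1 : (∑ l, repCoeff ρ c h k l • L2Sum.left h (untwist hV l x)) i g =
      ∑ l, repCoeff ρ c h k l * untwist hV l x i (h⁻¹ * g) := by
    rw [WithLp.ofLp_sum, Finset.sum_apply, L2.sum_apply]
    rfl
  rw [h1, untwist_apply]
  simp only [untwist_apply, Finset.mul_sum]
  rw [Finset.sum_comm]
  refine Finset.sum_congr rfl fun m _ => ?_
  simp only [← mul_assoc, ← Finset.sum_mul, ← repCoeff_mul]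
  simp [L2Sum.left]

open Classical in
theorem untwist_unit (k l : κ) (i : τ) :
    untwist hV k (L2Sum.unit (i, l) : L2Sum G (τ × κ)) = if k = l then L2Sum.unit i else 0 := by
  ext j g
  rw [untwist_apply]
  simp only [L2Sum.unit_apply, Prod.mk.injEq]
  rw [Finset.sum_eq_single l (fun m _ hm => by simp [hm]) (by simp)]
  by_cases hg : g = 1
  · subst hg
    rw [repCoeff_one]
    by_cases hk : k = l <;> simp [hk, L2Sum.unit_apply]
  · by_cases hk : k = l <;> simp [hk, hg, L2Sum.unit_apply]

/-- The subspace `L ⊗ V` of `(L²(G) ⊗_{ℂ[G]} M) ⊗ V`, seen in `L²(G) ⊗_{ℂ[G]} (M ⊗ V)_d`. -/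
def twistSubmodule (L : Submodule ℂ (L2Sum G τ)) : Submodule ℂ (L2Sum G (τ × κ)) :=
  ⨅ k, L.comap (untwist hV k).toLinearMap

theorem mem_twistSubmodule {L : Submodule ℂ (L2Sum G τ)} {x : L2Sum G (τ × κ)} :
    x ∈ twistSubmodule hV L ↔ ∀ k, untwist hV k x ∈ L := by
  simp [twistSubmodule]

theorem IsHilbertSubmodule.twist {L : Submodule ℂ (L2Sum G τ)} (hL : IsHilbertSubmodule L) :
    IsHilbertSubmodule (twistSubmodule hV L) := by
  constructor
  · have h1 : (twistSubmodule hV L : Set (L2Sum G (τ × κ))) =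
        ⋂ k, untwist hV k ⁻¹' (L : Set (L2Sum G τ)) := by
      ext x
      simp [mem_twistSubmodule]
    rw [h1]
    exact isClosed_iInter fun k => hL.1.preimage (untwist hV k).continuous
  · intro h x hx
    rw [mem_twistSubmodule] at hx ⊢
    intro k
    rw [untwist_left]
    exact L.sum_mem fun l _ => L.smul_mem _ (hL.2 h _ (hx l))

theorem twistSubmodule_inf (L L' : Submodule ℂ (L2Sum G τ)) :
    twistSubmodule hV (L ⊓ L') = twistSubmodule hV L ⊓ twistSubmodule hV L' := by
  ext x
  simp only [Submodule.mem_inf, mem_twistSubmodule, forall_and]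

theorem twistSubmodule_top : twistSubmodule hV (⊤ : Submodule ℂ (L2Sum G τ)) = ⊤ := by
  ext x
  simp [mem_twistSubmodule]

/-- `S` need not be all of `L ⊗ V`: components in `L`, together with all pure tensors `z ⊗ cₖ`,
determine the complement. This covers both `L ⊗ V` and ranges of operators, which need not be
closed. -/
theorem orthogonal_eq_twistSubmodule {L : Submodule ℂ (L2Sum G τ)}
    {S : Submodule ℂ (L2Sum G (τ × κ))}
    (hS : ∀ y ∈ S, ∀ k, untwist hV k y ∈ L)
    (hS' : ∀ k, ∀ z ∈ L, ∃ y ∈ S, untwist hV k y = z ∧ ∀ l ≠ k, untwist hV l y = 0) :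
    Sᗮ = twistSubmodule hV Lᗮ := by
  ext x
  rw [mem_twistSubmodule, Submodule.mem_orthogonal]
  simp only [Submodule.mem_orthogonal]
  constructor
  · intro hx k z hz
    obtain ⟨y, hy, hyz, hy0⟩ := hS' k z hz
    have h := hx y hy
    rwa [inner_eq_sum_untwist hV, Finset.sum_eq_single k (fun l _ hl => by
      rw [hy0 l hl, inner_zero_left]) (by simp), hyz] at h
  · intro hx y hy
    rw [inner_eq_sum_untwist hV]
    exact Finset.sum_eq_zero fun k _ => hx k _ (hS y hy k)

theorem exists_untwist_eq_single (k : κ) (z : L2Sum G τ) :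
    ∃ y, untwist hV k y = z ∧ ∀ l ≠ k, untwist hV l y = 0 := by
  classical
  obtain ⟨y, hy⟩ := exists_untwist_eq hV (Pi.single k z)
  exact ⟨y, by rw [hy, Pi.single_eq_same], fun l hl => by rw [hy, Pi.single_eq_of_ne hl]⟩

theorem orthogonal_twistSubmodule (L : Submodule ℂ (L2Sum G τ)) :
    (twistSubmodule hV L)ᗮ = twistSubmodule hV Lᗮ := by
  refine orthogonal_eq_twistSubmodule hV (fun y hy => (mem_twistSubmodule hV).1 hy)
    fun k z hz => ?_
  obtain ⟨y, hy, hy0⟩ := exists_untwist_eq_single hV k z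
  refine ⟨y, (mem_twistSubmodule hV).2 fun l => ?_, hy, hy0⟩
  by_cases hl : l = k
  · rwa [hl, hy]
  · rw [hy0 l hl]
    exact L.zero_mem

/-- The projection onto `L ⊗ V` acts on each component by the projection onto `L`. As `ρ(1) = 1`,
the vector `e_(i,l)` untwists to `eᵢ ⊗ c_l`, so each diagonal entry recurs once for every `l`. -/
theorem vnDim_twistSubmodule {L : Submodule ℂ (L2Sum G τ)} (hL : IsHilbertSubmodule L) :
    vnDim (twistSubmodule hV L) = Fintype.card κ * vnDim L := by
  classical
  have hL' := hL.twist hV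
  have := hL.hasOrthogonalProjection
  have := hL'.hasOrthogonalProjection
  have h1 : ∀ (i : τ) (l : κ), ⟪(L2Sum.unit (i, l) : L2Sum G (τ × κ)),
      (twistSubmodule hV L).starProjection (L2Sum.unit (i, l))⟫_ℂ =
      ⟪L2Sum.unit i, L.starProjection (L2Sum.unit i)⟫_ℂ := by
    intro i l
    obtain ⟨p, hp⟩ := exists_untwist_eq hV fun k =>
      L.starProjection (untwist hV k (L2Sum.unit (i, l) : L2Sum G (τ × κ)))
    have h2 : (twistSubmodule hV L).starProjection (L2Sum.unit (i, l)) = p := by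
      refine Submodule.eq_starProjection_of_mem_orthogonal ?_ ?_
      · rw [mem_twistSubmodule]
        intro k
        rw [hp]
        exact L.starProjection_apply_mem _
      · rw [orthogonal_twistSubmodule, mem_twistSubmodule]
        intro k
        rw [map_sub, hp]
        exact L.sub_starProjection_mem_orthogonal _
    rw [h2, inner_eq_sum_untwist hV, Finset.sum_eq_single l]
    · rw [hp, untwist_unit, if_pos rfl]
    · intro k _ hk
      rw [untwist_unit, if_neg hk, inner_zero_left]
    · simp
  rw [vnDim_eq hL.1, vnDim_eq hL'.1, vnTrace, Fintype.sum_prod_type]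
  simp only [h1, Finset.sum_const, Finset.card_univ, nsmul_eq_mul, ← Finset.mul_sum]
  rw [← vnTrace, ← Complex.ofReal_natCast, Complex.re_ofReal_mul]

variable {σ : Type*} [Fintype σ] {f : L2Sum G τ →L[ℂ] L2Sum G σ}
  {F : L2Sum G (τ × κ) →L[ℂ] L2Sum G (σ × κ)}

theorem ker_eq_twistSubmodule (hF : ∀ k x, untwist hV k (F x) = f (untwist hV k x)) :
    LinearMap.ker F.toLinearMap = twistSubmodule hV (LinearMap.ker f.toLinearMap) := by
  ext x
  simp only [mem_twistSubmodule, LinearMap.mem_ker, ContinuousLinearMap.coe_coe, ← hF]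
  constructor
  · intro h k
    rw [h, map_zero]
  · intro h
    have h1 := norm_sq_eq_sum_untwist hV (F x)
    simpa [h] using h1

theorem orthogonal_range_eq_twistSubmodule
    (hF : ∀ k x, untwist hV k (F x) = f (untwist hV k x)) :
    (LinearMap.range F.toLinearMap)ᗮ = twistSubmodule hV (LinearMap.range f.toLinearMap)ᗮ := by
  refine orthogonal_eq_twistSubmodule hV ?_ ?_
  · rintro _ ⟨x, rfl⟩ k
    exact ⟨untwist hV k x, (hF k x).symm⟩
  · rintro k _ ⟨z, rfl⟩
    obtain ⟨y, hy, hy0⟩ := exists_untwist_eq_single hV k z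
    refine ⟨F y, ⟨y, rfl⟩, ?_, fun l hl => ?_⟩
    · rw [hF, hy]
      rfl
    · rw [hF, hy0 l hl, map_zero]

theorem IsSpectralSubspace.twist (hF : ∀ k x, untwist hV k (F x) = f (untwist hV k x))
    {K E : Submodule ℂ (L2Sum G τ)} {r : ℝ} (h : IsSpectralSubspace f K r E) (hr : 0 ≤ r) :
    IsSpectralSubspace F (twistSubmodule hV K) r (twistSubmodule hV E) where
  le x hx := by
    rw [mem_twistSubmodule] at hx ⊢
    exact fun k => h.le (hx k)
  norm_le x hx := by
    rw [mem_twistSubmodule] at hx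
    refine le_of_sq_le_sq ?_ (by positivity)
    rw [mul_pow, norm_sq_eq_sum_untwist hV, norm_sq_eq_sum_untwist hV, Finset.mul_sum]
    refine Finset.sum_le_sum fun k _ => ?_
    rw [hF, ← mul_pow]
    exact pow_le_pow_left₀ (norm_nonneg _) (h.norm_le _ (hx k)) 2
  eq_zero x hx hxE hfx := by
    rw [orthogonal_twistSubmodule, mem_twistSubmodule] at hxE
    rw [mem_twistSubmodule] at hx
    have h1 := pow_le_pow_left₀ (norm_nonneg _) hfx 2
    rw [mul_pow, norm_sq_eq_sum_untwist hV, norm_sq_eq_sum_untwist hV, Finset.mul_sum] at h1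
    -- Each component obeys the reverse inequality, strictly unless it vanishes, so the summed bound
    -- `h1` forces all components to be zero.
    have h2 : ∀ k, (r * ‖untwist hV k x‖) ^ 2 ≤ ‖f (untwist hV k x)‖ ^ 2 := fun k => by
      refine pow_le_pow_left₀ (by positivity) ?_ 2
      by_contra hlt
      have h3 := h.eq_zero _ (hx k) (hxE k) (not_le.1 hlt).le
      simp [h3] at hlt
    have h4 : ∀ k, untwist hV k x = 0 := by
      intro k
      refine h.eq_zero _ (hx k) (hxE k) (le_of_sq_le_sq ?_ (by positivity))
      by_contra hlt
      refine absurd h1 (not_le.2 ?_)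
      refine Finset.sum_lt_sum (fun l _ => ?_) ⟨k, Finset.mem_univ k, ?_⟩
      · rw [hF, ← mul_pow]
        exact h2 l
      · rw [hF, ← mul_pow]
        exact not_le.1 hlt
    have h5 := norm_sq_eq_sum_untwist hV x
    simpa [h4] using h5

theorem spectralDensity_twist (hf : IsEquivariant f)
    (hF : ∀ k x, untwist hV k (F x) = f (untwist hV k x))
    {K : Submodule ℂ (L2Sum G τ)} (hK : IsHilbertSubmodule K) (r : ℝ) :
    spectralDensity F (twistSubmodule hV K) r = Fintype.card κ * spectralDensity f K r := by
  obtain hr | hr := lt_or_ge r 0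
  · rw [(isSpectralSubspace_bot F _ hr).spectralDensity_eq isHilbertSubmodule_bot,
      (isSpectralSubspace_bot f _ hr).spectralDensity_eq isHilbertSubmodule_bot, vnDim_bot,
      vnDim_bot, mul_zero]
  obtain ⟨E, hE, hfE⟩ := exists_isHilbertSubmodule_isSpectralSubspace hf hK r
  rw [hfE.spectralDensity_eq hE, (hfE.twist hV hF hr).spectralDensity_eq (hE.twist hV),
    vnDim_twistSubmodule hV hE]

theorem spectralDensity_top_twist (hf : IsEquivariant f)
    (hF : ∀ k x, untwist hV k (F x) = f (untwist hV k x)) (r : ℝ) :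
    spectralDensity F ⊤ r = Fintype.card κ * spectralDensity f ⊤ r := by
  rw [← twistSubmodule_top hV, spectralDensity_twist hV hf hF isHilbertSubmodule_top]

variable {υ : Type*} [Fintype υ] {f' : L2Sum G υ →L[ℂ] L2Sum G τ}
  {F' : L2Sum G (υ × κ) →L[ℂ] L2Sum G (τ × κ)}

theorem spectralDensity_orthogonal_range_twist (hf : IsEquivariant f)
    (hF : ∀ k x, untwist hV k (F x) = f (untwist hV k x)) (hf' : IsEquivariant f')
    (hF' : ∀ k x, untwist hV k (F' x) = f' (untwist hV k x)) (r : ℝ) :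
    spectralDensity F (LinearMap.range F'.toLinearMap)ᗮ r =
      Fintype.card κ * spectralDensity f (LinearMap.range f'.toLinearMap)ᗮ r := by
  rw [orthogonal_range_eq_twistSubmodule hV hF',
    spectralDensity_twist hV hf hF hf'.isHilbertSubmodule_orthogonal_range]

theorem vnDim_ker_inf_orthogonal_range_twist (hf : IsEquivariant f)
    (hF : ∀ k x, untwist hV k (F x) = f (untwist hV k x)) (hf' : IsEquivariant f')
    (hF' : ∀ k x, untwist hV k (F' x) = f' (untwist hV k x)) :
    vnDim (LinearMap.ker F.toLinearMap ⊓ (LinearMap.range F'.toLinearMap)ᗮ) =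
      Fintype.card κ *
        vnDim (LinearMap.ker f.toLinearMap ⊓ (LinearMap.range f'.toLinearMap)ᗮ) := by
  rw [orthogonal_range_eq_twistSubmodule hV hF', ker_eq_twistSubmodule hV hF,
    ← twistSubmodule_inf, vnDim_twistSubmodule hV
      (hf.isHilbertSubmodule_ker.inf hf'.isHilbertSubmodule_orthogonal_range)]

end Untwisting

/-! ### Matrix of the twisted map and its untwisting -/

section TwistedMatrix

variable {G : Type w} [Group G] {κ : Type w₂} [Fintype κ]
variable {V : Type v} [AddCommGroup V] [Module ℂ V] (ρ : Representation ℂ G V) (c : Basis κ ℂ V)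

/-- `∑ a_g g ↦ ∑ a_g ρ(g⁻¹)_{lk} g`. -/
def twistCoeff (l k : κ) : MonoidAlgebra ℂ G →ₗ[ℂ] MonoidAlgebra ℂ G :=
  (MonoidAlgebra.basis G ℂ).constr ℂ fun g => MonoidAlgebra.single g (repCoeff ρ c g⁻¹ l k)

theorem twistCoeff_single (l k : κ) (g : G) (t : ℂ) :
    twistCoeff ρ c l k (MonoidAlgebra.single g t) =
      MonoidAlgebra.single g (t * repCoeff ρ c g⁻¹ l k) := by
  have h1 : (MonoidAlgebra.single g t : MonoidAlgebra ℂ G) = t • MonoidAlgebra.basis G ℂ g := by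
    simp [MonoidAlgebra.basis_apply]
  rw [h1, map_smul, twistCoeff, Basis.constr_basis]
  simp

/-- For a group element this is `g y ⊗ cₖ = g (y ⊗ g⁻¹ cₖ)`, which explains the `g⁻¹` in
`twistCoeff`. -/
theorem DiagTensor.tmul_smul_basis {M : Type u} [AddCommGroup M] [Module ℂ M]
    [Module (MonoidAlgebra ℂ G) M] [IsScalarTower ℂ (MonoidAlgebra ℂ G) M]
    (a : MonoidAlgebra ℂ G) (y : M) (k : κ) :
    DiagTensor.tmul ρ (a • y) (c k) =
      ∑ l, twistCoeff ρ c l k a • DiagTensor.tmul ρ y (c l) := by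
  induction a using MonoidAlgebra.induction_linear with
  | zero => simp [DiagTensor.tmul]
  | add a b ha hb =>
    have h1 : DiagTensor.tmul ρ ((a + b) • y) (c k) =
        DiagTensor.tmul ρ (a • y) (c k) + DiagTensor.tmul ρ (b • y) (c k) := by
      rw [add_smul, DiagTensor.tmul, TensorProduct.add_tmul, map_add]
      rfl
    rw [h1, ha, hb, ← Finset.sum_add_distrib]
    simp only [map_add, add_smul]
  | single g t =>
    have h1 : c k = ρ g (∑ l, repCoeff ρ c g⁻¹ l k • c l) := by
      have h2 : ∑ l, repCoeff ρ c g⁻¹ l k • c l = ρ g⁻¹ (c k) := c.sum_repr _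
      rw [h2, Representation.self_inv_apply]
    have h3 : DiagTensor.tmul ρ ((MonoidAlgebra.single g t : MonoidAlgebra ℂ G) • y) (c k) =
        t • DiagTensor.tmul ρ ((MonoidAlgebra.single g 1 : MonoidAlgebra ℂ G) • y) (c k) := by
      have h4 : (MonoidAlgebra.single g t : MonoidAlgebra ℂ G) =
          t • MonoidAlgebra.single g 1 := by simp
      rw [h4, smul_assoc, DiagTensor.tmul, ← TensorProduct.smul_tmul', map_smul]
      rfl
    have h5 : ∀ x : M, DiagTensor.tmul ρ x (c k) =
        ∑ l, repCoeff ρ c g⁻¹ l k • DiagTensor.tmul ρ x (ρ g (c l)) := by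
      intro x
      rw [h1, map_sum, DiagTensor.tmul, TensorProduct.tmul_sum, map_sum]
      refine Finset.sum_congr rfl fun l _ => ?_
      rw [map_smul, TensorProduct.tmul_smul, map_smul]
      rfl
    rw [h3, h5, Finset.smul_sum]
    refine Finset.sum_congr rfl fun l _ => ?_
    rw [twistCoeff_single, DiagTensor.single_smul_tmul, mul_smul]

/-- For `a = h`, right multiplication evaluates at `g h⁻¹` and `twistCoeff` contributes `ρ(h⁻¹)`;
the product `ρ(g) ρ(h⁻¹) = ρ(g h⁻¹)` is exactly the matrix needed there. -/
theorem sum_repCoeff_mul_rightMul_twistCoeff (a : MonoidAlgebra ℂ G) (m : κ) (y : κ → L2 G)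
    (z : L2 G) (hz : ∀ g, z g = ∑ k, repCoeff ρ c g m k * y k g) (g : G) :
    ∑ l, repCoeff ρ c g m l * ∑ k, L2.rightMul (twistCoeff ρ c l k a) (y k) g =
      L2.rightMul a z g := by
  induction a using MonoidAlgebra.induction_linear with
  | zero => simp [L2.rightMul]
  | add a b ha hb =>
    have h1 : ∀ (a b : MonoidAlgebra ℂ G) (x : L2 G),
        L2.rightMul (a + b) x g = L2.rightMul a x g + L2.rightMul b x g := fun a b x => by
      simp [L2.rightMul]
    simp only [map_add, h1, Finset.sum_add_distrib, mul_add, ha, hb]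
  | single h t =>
    have h1 : ∀ (s : ℂ) (x : L2 G), L2.rightMul (MonoidAlgebra.single h s) x g =
        s * x (g * h⁻¹) := fun s x => by
      rw [L2.rightMul_single]
      simp
    simp only [twistCoeff_single, h1, hz, Finset.mul_sum, repCoeff_mul ρ c g h⁻¹, Finset.sum_mul]
    rw [Finset.sum_comm]
    refine Finset.sum_congr rfl fun k _ => Finset.sum_congr rfl fun l _ => ?_
    ring

variable {M : Type u} [AddCommGroup M] [Module ℂ M] [Module (MonoidAlgebra ℂ G) M]
  [IsScalarTower ℂ (MonoidAlgebra ℂ G) M]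
variable {N : Type u} [AddCommGroup N] [Module ℂ N] [Module (MonoidAlgebra ℂ G) N]
  [IsScalarTower ℂ (MonoidAlgebra ℂ G) N]
variable {τ : Type w₁} {σ : Type w₁} [Fintype τ] [Fintype σ]

theorem twistBasis_repr_twistMap (b : Basis τ (MonoidAlgebra ℂ G) M)
    (b' : Basis σ (MonoidAlgebra ℂ G) N) (f : M →ₗ[MonoidAlgebra ℂ G] N) (p : τ × κ) (q : σ × κ) :
    (twistBasis ρ b' c).repr (twistMap ρ f (twistBasis ρ b c p)) q =
      twistCoeff ρ c q.2 p.2 (b'.repr (f (b p.1)) q.1) := by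
  obtain ⟨i, k⟩ := p
  have h1 : twistMap ρ f (twistBasis ρ b c (i, k)) =
      ∑ q : σ × κ, twistCoeff ρ c q.2 k (b'.repr (f (b i)) q.1) • twistBasis ρ b' c q := by
    have h2 : ∀ s : σ → N, DiagTensor.tmul ρ (∑ j, s j) (c k) =
        ∑ j, DiagTensor.tmul ρ (s j) (c k) := by
      intro s
      rw [DiagTensor.tmul, TensorProduct.sum_tmul, map_sum]
      rfl
    rw [twistBasis_apply, twistMap_tmul, Fintype.sum_prod_type]
    conv_lhs => rw [← b'.sum_repr (f (b i)), h2]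
    simp only [DiagTensor.tmul_smul_basis, twistBasis_apply]
  rw [h1]
  exact congrFun ((twistBasis ρ b' c).repr_sum_self _) q

variable {ρ c}

theorem untwist_lambdaOp_twistMap (hV : IsUnitaryRep ρ c) (b : Basis τ (MonoidAlgebra ℂ G) M)
    (b' : Basis σ (MonoidAlgebra ℂ G) N) (f : M →ₗ[MonoidAlgebra ℂ G] N) (m : κ)
    (x : L2Sum G (τ × κ)) :
    untwist hV m (lambdaOp (twistBasis ρ b c) (twistBasis ρ b' c) (twistMap ρ f) x) =
      lambdaOp b b' f (untwist hV m x) := by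
  ext j g
  rw [untwist_apply]
  simp only [lambdaOp, L2Sum.matrixOp_apply, twistBasis_repr_twistMap, L2.sum_apply]
  simp only [Fintype.sum_prod_type, Finset.mul_sum]
  rw [Finset.sum_comm]
  refine Finset.sum_congr rfl fun i _ => ?_
  simp only [← Finset.mul_sum]
  exact sum_repCoeff_mul_rightMul_twistCoeff ρ c (b'.repr (f (b i)) j) m (fun k => x (i, k))
    (untwist hV m x i) (fun g => untwist_apply hV m x i g) g

end TwistedMatrix

/-! ### Effect of a constant factor on the derived invariants -/

section Invariants

variable {G : Type w} [Group G]

/-- The factor adds `ln t / ln r` to the quotient, and this tends to zero as `r → 0+`. -/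
theorem novikovShubin_const_mul {F F' : ℝ → ℝ} {t : ℝ} (ht : 0 < t)
    (h : ∀ r, 0 ≤ r → F' r = t * F r) : novikovShubin F' = novikovShubin F := by
  have h1 : (∀ r > 0, F' 0 < F' r) ↔ ∀ r > 0, F 0 < F r := by
    refine forall₂_congr fun r hr => ?_
    rw [h 0 le_rfl, h r (le_of_lt hr), mul_lt_mul_iff_right₀ ht]
  unfold novikovShubin
  by_cases h2 : ∀ r > 0, F 0 < F r
  · rw [if_pos h2, if_pos (h1.2 h2)]
    congr 1
    set u : ℝ → EReal := fun r => ((Real.log (F r - F 0) / Real.log r : ℝ) : EReal) with hu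
    set u' : ℝ → EReal := fun r => ((Real.log (F' r - F' 0) / Real.log r : ℝ) : EReal) with hu'
    set e : ℝ → EReal := fun r => ((Real.log t / Real.log r : ℝ) : EReal) with he
    have h3 : Tendsto (fun r : ℝ => Real.log t / Real.log r) (𝓝[>] 0) (𝓝 0) :=
      tendsto_const_nhds.div_atBot Real.tendsto_log_nhdsGT_zero
    have h4 : Tendsto e (𝓝[>] 0) (𝓝 0) := (continuous_coe_real_ereal.tendsto 0).comp h3
    have h5 : Tendsto (fun r => -e r) (𝓝[>] 0) (𝓝 0) := by
      have := (continuous_coe_real_ereal.tendsto (-0)).comp h3.neg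
      simpa [e, Function.comp_def] using this
    have h6 : u' =ᶠ[𝓝[>] 0] u + e := by
      filter_upwards [self_mem_nhdsWithin] with r hr
      have hr' : 0 < r := hr
      simp only [hu, hu', he, Pi.add_apply]
      rw [h 0 le_rfl, h r hr'.le, ← mul_sub, Real.log_mul ht.ne' (sub_pos.2 (h2 r hr')).ne',
        ← EReal.coe_add]
      congr 1
      ring
    have h7 : u =ᶠ[𝓝[>] 0] u' + fun r => -e r := by
      filter_upwards [h6] with r hr
      rw [Pi.add_apply, hr]
      simp only [hu, he, Pi.add_apply]
      norm_cast
      ring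
    -- The lower limit is only superadditive, so each inequality comes from adding the null function
    -- with one of its two signs.
    refine le_antisymm ?_ ?_
    · have := EReal.le_liminf_add (u := u') (v := fun r => -e r) (f := 𝓝[>] (0 : ℝ))
      rwa [← liminf_congr h7, h5.liminf_eq, add_zero] at this
    · have := EReal.le_liminf_add (u := u) (v := e) (f := 𝓝[>] (0 : ℝ))
      rwa [← liminf_congr h6, h4.liminf_eq, add_zero] at this
  · rw [if_neg h2, if_neg (mt h1.1 h2)]

variable {τ τ' σ σ' : Type*} [Fintype τ] [Fintype σ] [Fintype τ'] [Fintype σ']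

/-- The Stieltjes function is the right limit of the density, which commutes with scaling. The
factor `t = 0` is allowed, which covers `V = 0`. -/
theorem spectralMeasure_eq_smul {f : L2Sum G τ →L[ℂ] L2Sum G σ}
    {F : L2Sum G τ' →L[ℂ] L2Sum G σ'}
    {t : NNReal} (h : ∀ r, spectralDensity F ⊤ r = t * spectralDensity f ⊤ r) :
    spectralMeasure F = t • spectralMeasure f := by
  rw [spectralMeasure, spectralMeasure, ← StieltjesFunction.measure_smul]
  congr 1
  ext r
  change (spectralDensity_mono F ⊤).stieltjesFunction r =
    (t : ℝ) * (spectralDensity_mono f ⊤).stieltjesFunction r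
  rw [Monotone.stieltjesFunction_eq, Monotone.stieltjesFunction_eq]
  refine tendsto_nhds_unique ((spectralDensity_mono F ⊤).tendsto_rightLim r) ?_
  rw [show spectralDensity F ⊤ = fun r => (t : ℝ) * spectralDensity f ⊤ r from funext h]
  exact ((spectralDensity_mono f ⊤).tendsto_rightLim r).const_mul _

theorem IsDetClass.of_spectralMeasure_eq_smul {f : L2Sum G τ →L[ℂ] L2Sum G σ}
    {F : L2Sum G τ' →L[ℂ] L2Sum G σ'} {t : NNReal}
    (h : spectralMeasure F = t • spectralMeasure f) (hf : IsDetClass f) : IsDetClass F := by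
  rw [IsDetClass, MeasureTheory.IntegrableOn] at hf ⊢
  rw [h, MeasureTheory.Measure.restrict_smul]
  exact hf.smul_measure_nnreal

theorem IsDetClass.log_fkDet {f : L2Sum G τ →L[ℂ] L2Sum G σ} (hf : IsDetClass f) :
    Real.log (fkDet f) = ∫ r in Set.Ioi 0, Real.log r ∂(spectralMeasure f) := by
  rw [fkDet, if_pos hf, Real.log_exp]

theorem IsDetClass.log_fkDet_eq_mul {f : L2Sum G τ →L[ℂ] L2Sum G σ}
    {F : L2Sum G τ' →L[ℂ] L2Sum G σ'} {t : NNReal}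
    (h : spectralMeasure F = t • spectralMeasure f) (hf : IsDetClass f) :
    Real.log (fkDet F) = t * Real.log (fkDet f) := by
  rw [(hf.of_spectralMeasure_eq_smul h).log_fkDet, hf.log_fkDet, h,
    MeasureTheory.Measure.restrict_smul, MeasureTheory.integral_smul_nnreal_measure]
  rfl

end Invariants

/-! ### Application to the twisted complex -/

section TwistedComplex

variable {G : Type w} [Group G] (C : BasedComplex.{u, w, w₁} G)
variable {V : Type v} [AddCommGroup V] [Module ℂ V] {ρ : Representation ℂ G V}
variable {κ : Type w₂} [Fintype κ] {c : Basis κ ℂ V}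

/-- The differentials of `Λ(η(C_*))`, with their index types in unfolded form. -/
abbrev twistedDifferential (ρ : Representation ℂ G V) (c : Basis κ ℂ V) (i j : ℤ) :
    L2Sum G (C.ι i × κ) →L[ℂ] L2Sum G (C.ι j × κ) :=
  (C.twist ρ c).lambda.d i j

theorem untwist_twistedDifferential (hV : IsUnitaryRep ρ c) (i j : ℤ) (m : κ)
    (x : L2Sum G (C.ι i × κ)) :
    untwist hV m (twistedDifferential C ρ c i j x) = C.lambda.d i j (untwist hV m x) :=
  untwist_lambdaOp_twistMap hV (C.basis i) (C.basis j) (C.cx.d i j).hom m x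

theorem specDensity_twist (hV : IsUnitaryRep ρ c) (n : ℤ) (r : ℝ) :
    (C.twist ρ c).lambda.specDensity n r = Fintype.card κ * C.lambda.specDensity n r :=
  spectralDensity_orthogonal_range_twist hV (C.lambda.equivariant n (n - 1))
    (untwist_twistedDifferential C hV n (n - 1)) (C.lambda.equivariant (n + 1) n)
    (untwist_twistedDifferential C hV (n + 1) n) r

theorem betti_twist (hV : IsUnitaryRep ρ c) (n : ℤ) :
    (C.twist ρ c).lambda.betti n = Fintype.card κ * C.lambda.betti n :=
  vnDim_ker_inf_orthogonal_range_twist hV (C.lambda.equivariant n (n - 1))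
    (untwist_twistedDifferential C hV n (n - 1)) (C.lambda.equivariant (n + 1) n)
    (untwist_twistedDifferential C hV (n + 1) n)

theorem spectralMeasure_twist (hV : IsUnitaryRep ρ c) (n : ℤ) :
    spectralMeasure ((C.twist ρ c).lambda.d n (n - 1)) =
      (Fintype.card κ : NNReal) • spectralMeasure (C.lambda.d n (n - 1)) :=
  spectralMeasure_eq_smul fun r => by
    rw [NNReal.coe_natCast]
    exact spectralDensity_top_twist hV (C.lambda.equivariant n (n - 1))
      (untwist_twistedDifferential C hV n (n - 1)) r

end TwistedComplex

end L2Twist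

end

theorem mainTheorem6 {G : Type*} [Group G]
    (C : L2Twist.BasedComplex G)
    {V : Type*} [AddCommGroup V] [Module ℂ V] (ρ : Representation ℂ G V)
    {κ : Type*} [Fintype κ] (c : Module.Basis κ ℂ V)
    (hV : L2Twist.IsUnitaryRep ρ c) :
    -- spectral density functions
    (∀ (n : ℤ) (r : ℝ), 0 ≤ r →
      (C.twist ρ c).lambda.specDensity n r =
        (Module.finrank ℂ V : ℝ) * C.lambda.specDensity n r) ∧
    -- Betti numbers
    (∀ n : ℤ, (C.twist ρ c).lambda.betti n = (Module.finrank ℂ V : ℝ) * C.lambda.betti n) ∧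
    -- Novikov-Shubin invariants
    (Nontrivial V → ∀ n : ℤ, (C.twist ρ c).lambda.alpha n = C.lambda.alpha n) ∧
    -- determinant class and torsion
    (Nontrivial V →
      ((C.twist ρ c).lambda.IsDeterminantClass ↔ C.lambda.IsDeterminantClass)) ∧
    (C.lambda.IsDeterminantClass →
      (C.twist ρ c).lambda.IsDeterminantClass ∧
      (C.twist ρ c).lambda.torsion = (Module.finrank ℂ V : ℝ) * C.lambda.torsion) := by
  rw [Module.finrank_eq_card_basis c]
  have hcard : Nontrivial V → (0 : ℝ) < Fintype.card κ := fun _ => by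
    have := c.index_nonempty
    exact_mod_cast Fintype.card_pos
  refine ⟨fun n r _ => L2Twist.specDensity_twist C hV n r, L2Twist.betti_twist C hV,
    fun hn n => L2Twist.novikovShubin_const_mul (hcard hn)
      fun r _ => L2Twist.specDensity_twist C hV n r,
    fun hn => ⟨fun h n => ?_, fun h n => ?_⟩, fun h => ⟨fun n => ?_, ?_⟩⟩
  -- For `V ≠ 0` the relation between the measures can be inverted, so the same transfer lemma
  -- yields the converse.
  · have hne : (Fintype.card κ : NNReal) ≠ 0 := by exact_mod_cast (hcard hn).ne'
    refine (h n).of_spectralMeasure_eq_smul (t := (Fintype.card κ : NNReal)⁻¹) ?_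
    rw [L2Twist.spectralMeasure_twist C hV, smul_smul, inv_mul_cancel₀ hne, one_smul]
  · exact (h n).of_spectralMeasure_eq_smul (L2Twist.spectralMeasure_twist C hV n)
  · exact (h n).of_spectralMeasure_eq_smul (L2Twist.spectralMeasure_twist C hV n)
  · rw [L2Twist.HilbertComplex.torsion, L2Twist.HilbertComplex.torsion, mul_neg, mul_finsum]
    congr 1
    refine finsum_congr fun n => ?_
    rw [(h n).log_fkDet_eq_mul (L2Twist.spectralMeasure_twist C hV n), NNReal.coe_natCast]
    ring
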